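/- **Source calculus $\lambda_{cs}^{\forall}$.** Locations are $Loc ::= \mathbf c \mid \mathbf s \mid l$ (client, server, location variable); $a,b$ range over $\{\mathbf c,\mathbf s\}$. The syntax is - types $A,B ::= base \mid A\xrightarrow{Loc}B \mid Clo(A) \mid A\times B \mid \alpha \mid \forall\alpha.A \mid \forall l.A \mid T\,A$; - values $V,W ::= x \mid (V,W) \mid clo(\overline W, F[\overline{Loc}\,\overline A]) \mid \Lambda\alpha.\mathsf{unit}\,V \mid \mathsf{unit}\,V \mid \mathsf{do}\,x\leftarrow M;N \mid req(V,W) \mid call(V,W) \mid gen(Loc,V,W)$; - terms $M,N ::= V \mid \mathsf{let}\,x=M\,\mathsf{in}\,N \mid \pi_i(V) \mid V(W) \mid V[A] \mid V[Loc]$. A program is a pair of function maps $(\Phi_{\mathbf c},\Phi_{\mathbf s})$ with bindings $F:\overline l\,\overline\alpha.\overline B.A=\overline l\,\overline\alpha.\overline z.o$, where $o$ is $\lambda x.M$ or $\Lambda l.V$ and the variables $\overline z$ (and $x$) are distinct; $\Phi(F[\overline{Loc}\,\overline A])=\overline z.\,o\{\overline{Loc}\,\overline A/\overline l\,\overline\alpha\}$.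 A type is *relocatable* if it is $base$, $\alpha$, $Clo(A)$, $\forall\alpha.A$, or a product of relocatable types. *Typing.* Judgments $\Gamma\vdash_{Loc}M:A$, with all type and location variables bound in $\Gamma$, are given by the usual rules for variables, $\mathsf{let}$, pairs, and projections and by the following rules. - $\mathsf{unit}\,V:T A$ if $V:A$ with $A$ relocatable; $(\mathsf{do}\,x\leftarrow M;N):T B$ if $M:T A$ and $N:T B$ under $x:A$. - $\Lambda\alpha.V':\forall\alpha.A$ if $\Gamma,\alpha\vdash_{Loc_0}V':A$ for every $Loc_0$; $V[B]:A\{B/\alpha\}$ if $V:\forall\alpha.A$ and $B$ is relocatable; $V[Loc']:A\{Loc'/l\}$ if $V:Clo(\forall l.A)$. - $V(W):B$ at $Loc$ if $V:Clo(A\xrightarrow{Loc}B)$ and $W:A$. - If $V:Clo(A\xrightarrow{Loc'}T B)$ and $W:A$ with $A$ relocatable, then $gen(Loc',V,W):T B$; moreover $req(V,W):T B$ at $\mathbf c$ if $Loc'=\mathbf s$, and $call(V,W):T B$ at $\mathbf s$ if $Loc'=\mathbf c$. - If $F:\overline l\,\overline\alpha.\overline B.A$ is a binding with $\overline B$ relocatable,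 $\theta=\{\overline{Loc}\,\overline A/\overline l\,\overline\alpha\}$ with $\overline A$ relocatable, and $\Gamma\vdash_{Loc}\overline W:\overline{B\theta}$, then $clo(\overline W,F[\overline{Loc}\,\overline A]):Clo(A\theta)$. The program is *well-formed* if $\Phi_{\mathbf c}\cup\Phi_{\mathbf s}$ is the union of three maps $\Phi^\circ_{\mathbf c},\Phi^\circ_{\mathbf s},\Phi_{common}$ with disjoint sets of names, and every binding has closed type and code and satisfies one of the following: $A=A_1\xrightarrow{Loc}A_2$, $o=\lambda x.M$, $\overline l,\overline\alpha,\overline{z:B},x:A_1\vdash_{Loc}M:A_2$, and the binding lies in $\Phi^\circ_a$ if $Loc=a$ and in $\Phi_{common}$ if $Loc$ is a variable; or $A=\forall l.A_1$, $o=\Lambda l.V$, $\overline l,\overline\alpha,\overline{z:B},l\vdash_{Loc}V:A_1$ for every $Loc$, and the binding lies in $\Phi_{common}$. (The closure rule looks bindings up in the same parts.) *Reduction.* Evaluation contexts are $E::=E_{let}\mid\mathsf{do}\,x\leftarrow E;M$ and $E_{let}::=[\,]\mid\mathsf{let}\,x=E_{let}\,\mathsf{in}\,M$; a stack $\Delta$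 is a list of evaluation contexts ($\epsilon$ is the empty one); configurations are $\langle M;\Delta_{\mathbf c}\mid\Delta_{\mathbf s}\rangle$ and $\langle\Delta_{\mathbf c}\mid M;\Delta_{\mathbf s}\rangle$. Local reductions at $a$, performed inside any $E$ on the running side, are $\mathsf{let}\,x=V\,\mathsf{in}\,M\to M\{V/x\}$; $\mathsf{do}\,x\leftarrow\mathsf{unit}\,V;M\to M\{V/x\}$; $\pi_i(V_1,V_2)\to V_i$; $(\Lambda\alpha.V)[A]\to V\{A/\alpha\}$; $clo(\overline W,F)(V)\to M\{\overline W/\overline z\}\{V/x\}$ if $\Phi_a(F)=\overline z.\lambda x.M$; $clo(\overline W,F)[b]\to V\{\overline W/\overline z\}\{b/l\}$ if $\Phi_a(F)=\overline z.\Lambda l.V$. The communication steps are - $\langle E[req(V,W)];\Delta_{\mathbf c}\mid\Delta_{\mathbf s}\rangle\to\langle E;\Delta_{\mathbf c}\mid V(W);\Delta_{\mathbf s}\rangle$ and $\langle\Delta_{\mathbf c}\mid E[call(V,W)];\Delta_{\mathbf s}\rangle\to\langle V(W);\Delta_{\mathbf c}\mid E;\Delta_{\mathbf s}\rangle$; -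 $\langle\mathsf{unit}\,V;\Delta_{\mathbf c}\mid E;\Delta_{\mathbf s}\rangle\to\langle\Delta_{\mathbf c}\mid E[\mathsf{unit}\,V];\Delta_{\mathbf s}\rangle$, $\langle E;\Delta_{\mathbf c}\mid\mathsf{unit}\,V;\Delta_{\mathbf s}\rangle\to\langle E[\mathsf{unit}\,V];\Delta_{\mathbf c}\mid\Delta_{\mathbf s}\rangle$, and $\langle\epsilon\mid\mathsf{unit}\,V;\epsilon\rangle\to\langle\mathsf{unit}\,V;\epsilon\mid\epsilon\rangle$; - inside $E$ on the running side, $gen(\mathbf c,V,W)$ becomes $V(W)$ at the client and $call(V,W)$ at the server, and $gen(\mathbf s,V,W)$ becomes $req(V,W)$ at the client and $V(W)$ at the server. **Target calculus $\lambda_{cs}$.** Values are $v,w::=x\mid(v,w)\mid Con\,\overline v\mid\mathsf{unit}\,v\mid\mathsf{do}\,x\leftarrow m;n$ and terms are $m,n::=v\mid\mathsf{let}\,x=m\,\mathsf{in}\,n\mid\pi_i(v)\mid v(w)\mid send\,v\mid receive\mid\mathsf{case}\,v\,\mathsf{of}\,\{\overline{Con\,\overline x\to m}\}$, with constructors $Client$,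 $Server$, $Apply$, $Ret$, and $Closure_F$ for function names $F$ (one writes $Closure\,\overline v\,F$ for $Closure_F\,\overline v$). Function maps send names to codes $\overline z.\lambda x.m$. The evaluation contexts $e$ have the same shape as before, and $\mathsf{do}\ send\,v;m$ denotes $\mathsf{do}\,x\leftarrow send\,v;m$ with $x$ unused. The expression $loop\,()$ is identified with its body $$\mathsf{do}\,x\leftarrow receive;\ \mathsf{case}\,x\,\mathsf{of}\,\{Apply\,f\,arg\to\mathsf{do}\,z\leftarrow f(arg);\ \mathsf{do}\ send\,(Ret\,z);\ loop\,();\quad Ret\,y\to\mathsf{unit}\,y\}.$$ Configurations are $\langle m_{\mathbf c}\mid m_{\mathbf s}\rangle$. While one side has the form $e_2[\mathsf{do}\,x\leftarrow receive;m_2]$, the other side may take a local step inside an evaluation context (the reductions for $\mathsf{let}$, $\mathsf{do}$, and $\pi_i$ as above; $(Closure\,\overline w\,F)(v)\to m\{\overline w/\overline z\}\{v/x\}$ if this side's map sends $F$ to $\overline z.\lambda x.m$; and the usual reduction of $\mathsf{case}$), or, if it has the form $e_1[\mathsf{do}\ send\,v;m_1]$, both sides step together to $e_1[m_1]$ and $e_2[m_2\{v/x\}]$.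 **Compilation.** $[\![l]\!]=x_l$, $[\![\mathbf c]\!]=Client$, $[\![\mathbf s]\!]=Server$. The map $[\![\cdot]\!]_a$ commutes with variables, pairs, projections, $\mathsf{unit}$, $\mathsf{do}$, $\mathsf{let}$ and $V(W)$, and - $[\![clo(\overline W,F[\overline{Loc}\,\overline A])]\!]_a=Closure\,(\overline{[\![Loc]\!]}\,\overline{[\![W]\!]_a})\,F$; - $[\![\Lambda\alpha.\mathsf{unit}\,V]\!]_a=[\![V]\!]_a$, $[\![V[A]]\!]_a=\mathsf{unit}\,[\![V]\!]_a$, $[\![V[Loc]]\!]_a=[\![V]\!]_a([\![Loc]\!])$; - $[\![req(V,W)]\!]_a=[\![call(V,W)]\!]_a=\mathsf{do}\ send\,(Apply\,[\![V]\!]_a\,[\![W]\!]_a);\ loop\,()$; - $[\![gen(Loc,V,W)]\!]_a=\mathsf{do}\,x\leftarrow\mathsf{case}\,[\![Loc]\!]\,\mathsf{of}\,\{Client\to m_1;Server\to m_2\};\ \mathsf{unit}\,x$, where $(m_1,m_2)$ is $([\![V(W)]\!]_{\mathbf c},[\![req(V,W)]\!]_{\mathbf c})$ for $a=\mathbf c$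 and $([\![call(V,W)]\!]_{\mathbf s},[\![V(W)]\!]_{\mathbf s})$ for $a=\mathbf s$. A code $\overline l\,\overline\alpha.\overline z.o$ compiles at $a$ to $\overline{x_l}\,\overline z.[\![o]\!]_a$, with $[\![\lambda x.M]\!]_a=\lambda x.[\![M]\!]_a$ and $[\![\Lambda l.V]\!]_a=\lambda x_l.[\![V]\!]_a$, and $(\Phi_{\mathbf c},\Phi_{\mathbf s})$ compiles to $([\![\Phi_{\mathbf c}]\!]_{\mathbf c},[\![\Phi_{\mathbf s}]\!]_{\mathbf s})$. **Theorem (semantic correctness of the compilation of $\lambda_{cs}^{\forall}$ into $\lambda_{cs}$).** Let $(\Phi_{\mathbf c},\Phi_{\mathbf s})$ be a well-formed program and $M$ a closed main term with $\emptyset\vdash_{\mathbf c}M:T A$ for some type $A$. If $\langle M;\epsilon\mid\epsilon\rangle\longrightarrow^*\langle\mathsf{unit}\,V;\epsilon\mid\epsilon\rangle$ in $\lambda_{cs}^{\forall}$ under $(\Phi_{\mathbf c},\Phi_{\mathbf s})$, then $$\langle[\![M]\!]_{\mathbf c}\mid loop\,()\rangle\longrightarrow^*\langle[\![\mathsf{unit}\,V]\!]_{\mathbf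 c}\mid loop\,()\rangle$$ in $\lambda_{cs}$ under the compiled program. -/

import Mathlib

namespace LamCS

/-! ## Locations, names, lists as substitutions -/

/-- The two location constants: the client **c** and the server **s**. -/
inductive Side where
  | c
  | s
deriving DecidableEq

/-- Locations: a constant, or a location variable (a de Bruijn index). -/
inductive Loc where
  | const (a : Side)
  | var (i : ℕ)
deriving DecidableEq

/-- Term variables are named; type and location variables are de Bruijn indices. -/
abbrev Name := ℕ

/-- Names of functions. -/
abbrev FName := ℕ

/-- The substitution that replaces the variables `0, …, n - 1` by the entries of a list of
length `n` and lowers the remaining variables by `n`. -/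
def ofList {α : Type} (v : ℕ → α) (as : List α) : ℕ → α :=
  fun i => as.getD i (v (i - as.length))

/-- No location variable `≥ nl`. -/
def Loc.WF (nl : ℕ) : Loc → Prop
  | .const _ => True
  | .var i => i < nl

def Loc.ren (ρ : ℕ → ℕ) : Loc → Loc
  | .const a => .const a
  | .var i => .var (ρ i)

def Loc.subst (σ : ℕ → Loc) : Loc → Loc
  | .const a => .const a
  | .var i => σ i

/-- A renaming under one more binder. -/
def liftRen (ρ : ℕ → ℕ) : ℕ → ℕ
  | 0 => 0
  | i + 1 => ρ i + 1

/-- A location substitution under one more location binder. -/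
def liftL (σ : ℕ → Loc) : ℕ → Loc
  | 0 => .var 0
  | i + 1 => (σ i).ren Nat.succ

/-! ## Types -/

inductive Ty where
  /-- `base` -/
  | base
  /-- `A →^Loc B` -/
  | fn (A : Ty) (L : Loc) (B : Ty)
  /-- `Clo(A)` -/
  | clo (A : Ty)
  /-- `A × B` -/
  | prod (A B : Ty)
  /-- a type variable -/
  | var (i : ℕ)
  /-- `∀ α. A` -/
  | allT (A : Ty)
  /-- `∀ l. A` -/
  | allL (A : Ty)
  /-- the monadic type `T A` -/
  | T (A : Ty)

namespace Ty

/-- Free location variables `< nl`, free type variables `< nt`. -/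
def WF : ℕ → ℕ → Ty → Prop
  | _, _, base => True
  | nl, nt, fn A L B => WF nl nt A ∧ L.WF nl ∧ WF nl nt B
  | nl, nt, clo A => WF nl nt A
  | nl, nt, prod A B => WF nl nt A ∧ WF nl nt B
  | _, nt, var i => i < nt
  | nl, nt, allT A => WF nl (nt + 1) A
  | nl, nt, allL A => WF (nl + 1) nt A
  | nl, nt, T A => WF nl nt A

/-- Renaming of location variables by `ρl` and of type variables by `ρt`. -/
def ren : (ℕ → ℕ) → (ℕ → ℕ) → Ty → Ty
  | _, _, base => base
  | ρl, ρt, fn A L B => fn (ren ρl ρt A) (L.ren ρl) (ren ρl ρt B)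
  | ρl, ρt, clo A => clo (ren ρl ρt A)
  | ρl, ρt, prod A B => prod (ren ρl ρt A) (ren ρl ρt B)
  | _, ρt, var i => var (ρt i)
  | ρl, ρt, allT A => allT (ren ρl (liftRen ρt) A)
  | ρl, ρt, allL A => allL (ren (liftRen ρl) ρt A)
  | ρl, ρt, T A => T (ren ρl ρt A)

/-- Weakening by one location variable. -/
def shiftL (A : Ty) : Ty := ren Nat.succ id A

/-- Weakening by one type variable. -/
def shiftT (A : Ty) : Ty := ren id Nat.succ A

/-- A type substitution under one more type binder. -/
def liftT (σ : ℕ → Ty) : ℕ → Ty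
  | 0 => var 0
  | i + 1 => (σ i).shiftT

/-- Simultaneous capture-avoiding substitution for location and type variables. -/
def subst : (ℕ → Loc) → (ℕ → Ty) → Ty → Ty
  | _, _, base => base
  | σl, σt, fn A L B => fn (subst σl σt A) (L.subst σl) (subst σl σt B)
  | σl, σt, clo A => clo (subst σl σt A)
  | σl, σt, prod A B => prod (subst σl σt A) (subst σl σt B)
  | _, σt, var i => σt i
  | σl, σt, allT A => allT (subst σl (liftT σt) A)
  | σl, σt, allL A => allL (subst (liftL σl) (fun i => (σt i).shiftL) A)
  | σl, σt, T A => T (subst σl σt A)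

/-- `A{B/α}` for the outermost bound variable `α` of `∀ α. A`. -/
def instT (A B : Ty) : Ty := A.subst Loc.var (ofList var [B])

/-- `A{L/l}` for the outermost bound variable `l` of `∀ l. A`. -/
def instL (A : Ty) (L : Loc) : Ty := A.subst (ofList Loc.var [L]) var

/-- The relocatable types. -/
def Reloc : Ty → Prop
  | base => True
  | clo _ => True
  | var _ => True
  | allT _ => True
  | prod A B => Reloc A ∧ Reloc B
  | fn _ _ _ => False
  | allL _ => False
  | T _ => False

end Ty

/-! ## Terms of the polymorphic calculus -/

mutual
  /-- Values. -/
  inductive Val where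
    | var (x : Name)
    | pair (V W : Val)
    /-- `clo(W̄, F[L̄ Ā])` -/
    | clo (Ws : List Val) (F : FName) (Ls : List Loc) (As : List Ty)
    /-- `Λ α. unit V`: the body of a type abstraction is always of the form `unit V`. -/
    | tabs (V : Val)
    | unit (V : Val)
    /-- `do x ← M; N` -/
    | bind (x : Name) (M N : Tm)
    | req (V W : Val)
    | call (V W : Val)
    | gen (L : Loc) (V W : Val)
  /-- Terms. -/
  inductive Tm where
    | val (V : Val)
    /-- `let x = M in N` -/
    | letin (x : Name) (M N : Tm)
    /-- `π₁(V)` is `proj 0 V`, and `π₂(V)` is `proj 1 V`. -/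
    | proj (i : Fin 2) (V : Val)
    | app (V W : Val)
    /-- `V[A]` -/
    | tapp (V : Val) (A : Ty)
    /-- `V[L]` -/
    | lapp (V : Val) (L : Loc)
end

/- Substitution `M{W/x}` of a value for a term variable. (Reduction only ever substitutes closed
values, so no renaming of bound term variables is needed.) -/
mutual
  def Val.subst : Val → Name → Val → Val
    | .var y, x, U => if x = y then U else .var y
    | .pair V W, x, U => .pair (V.subst x U) (W.subst x U)
    | .clo Ws F Ls As, x, U => .clo (Val.substList Ws x U) F Ls As
    | .tabs V, x, U => .tabs (V.subst x U)
    | .unit V, x, U => .unit (V.subst x U)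
    | .bind y M N, x, U => .bind y (M.subst x U) (if x = y then N else N.subst x U)
    | .req V W, x, U => .req (V.subst x U) (W.subst x U)
    | .call V W, x, U => .call (V.subst x U) (W.subst x U)
    | .gen L V W, x, U => .gen L (V.subst x U) (W.subst x U)
  def Val.substList : List Val → Name → Val → List Val
    | [], _, _ => []
    | V :: Vs, x, U => V.subst x U :: Val.substList Vs x U
  def Tm.subst : Tm → Name → Val → Tm
    | .val V, x, U => .val (V.subst x U)
    | .letin y M N, x, U => .letin y (M.subst x U) (if x = y then N else N.subst x U)
    | .proj i V, x, U => .proj i (V.subst x U)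
    | .app V W, x, U => .app (V.subst x U) (W.subst x U)
    | .tapp V A, x, U => .tapp (V.subst x U) A
    | .lapp V L, x, U => .lapp (V.subst x U) L
end

/-- `M{W̄/z̄}` -/
def Tm.substs (M : Tm) (zs : List Name) (Ws : List Val) : Tm :=
  (zs.zip Ws).foldl (fun N p => N.subst p.1 p.2) M

/-- `V{W̄/z̄}` -/
def Val.substs (V : Val) (zs : List Name) (Ws : List Val) : Val :=
  (zs.zip Ws).foldl (fun U p => U.subst p.1 p.2) V

/- Simultaneous substitution of locations and types for location and type variables. -/
mutual
  def Val.inst : (ℕ → Loc) → (ℕ → Ty) → Val → Val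
    | _, _, .var y => .var y
    | σl, σt, .pair V W => .pair (V.inst σl σt) (W.inst σl σt)
    | σl, σt, .clo Ws F Ls As =>
        .clo (Val.instList σl σt Ws) F (Ls.map (Loc.subst σl)) (As.map (Ty.subst σl σt))
    | σl, σt, .tabs V => .tabs (V.inst σl (Ty.liftT σt))
    | σl, σt, .unit V => .unit (V.inst σl σt)
    | σl, σt, .bind y M N => .bind y (M.inst σl σt) (N.inst σl σt)
    | σl, σt, .req V W => .req (V.inst σl σt) (W.inst σl σt)
    | σl, σt, .call V W => .call (V.inst σl σt) (W.inst σl σt)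
    | σl, σt, .gen L V W => .gen (L.subst σl) (V.inst σl σt) (W.inst σl σt)
  def Val.instList : (ℕ → Loc) → (ℕ → Ty) → List Val → List Val
    | _, _, [] => []
    | σl, σt, V :: Vs => V.inst σl σt :: Val.instList σl σt Vs
  def Tm.inst : (ℕ → Loc) → (ℕ → Ty) → Tm → Tm
    | σl, σt, .val V => .val (V.inst σl σt)
    | σl, σt, .letin y M N => .letin y (M.inst σl σt) (N.inst σl σt)
    | σl, σt, .proj i V => .proj i (V.inst σl σt)
    | σl, σt, .app V W => .app (V.inst σl σt) (W.inst σl σt)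
    | σl, σt, .tapp V A => .tapp (V.inst σl σt) (A.subst σl σt)
    | σl, σt, .lapp V L => .lapp (V.inst σl σt) (L.subst σl)
end

/-- `V{A/α}` for the variable `α` bound by the outermost type abstraction. -/
def Val.instT (V : Val) (A : Ty) : Val := V.inst Loc.var (ofList Ty.var [A])

/-- `V{L/l}` for the variable `l` bound by the location abstraction. -/
def Val.instL (V : Val) (L : Loc) : Val := V.inst (ofList Loc.var [L]) Ty.var

/-! ## Programs -/

/-- Open codes `λ x. M` and `Λ l. V`. In `Λ l. V` the variable `l` has index `0` in `V`. -/
inductive OpenCode where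
  | lam (x : Name) (M : Tm)
  | llam (V : Val)

/-- `OpenCode{L̄ Ā / l̄ ᾱ}` -/
def OpenCode.inst (Ls : List Loc) (As : List Ty) : OpenCode → OpenCode
  | lam x M => lam x (M.inst (ofList Loc.var Ls) (ofList Ty.var As))
  | llam V => llam (V.inst (liftL (ofList Loc.var Ls)) (fun i => (ofList Ty.var As i).shiftL))

/-- The data bound to a function name: the type `l̄ ᾱ. B̄. A` and the code
`l̄ ᾱ. z̄. OpenCode`, with `nl` location variables `l̄` and `nt` type variables `ᾱ`. -/
structure FunDef where
  nl : ℕ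
  nt : ℕ
  Bs : List Ty
  ty : Ty
  zs : List Name
  code : OpenCode

/-- Function maps. -/
abbrev FunMap := FName → Option FunDef

/-- A program: the client function map and the server function map. -/
structure Program where
  client : FunMap
  server : FunMap

def Program.at (P : Program) : Side → FunMap
  | .c => P.client
  | .s => P.server

/-- `Lookup Φ F Ls As zs o` says `Φ(F[L̄ Ā]) = z̄. o`. -/
def Lookup (Φ : FunMap) (F : FName) (Ls : List Loc) (As : List Ty)
    (zs : List Name) (o : OpenCode) : Prop :=
  ∃ d, Φ F = some d ∧ Ls.length = d.nl ∧ As.length = d.nt ∧ zs = d.zs ∧ o = d.code.inst Ls As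

/-! ## The type system -/

/-- A decomposition of the bindings of a program into client functions, server functions
and common functions. -/
structure Decomp where
  client : FunMap
  server : FunMap
  common : FunMap

/-- The part in which functions of location `L` live. -/
def Decomp.at (D : Decomp) : Loc → FunMap
  | .const .c => D.client
  | .const .s => D.server
  | .var _ => D.common

/-- Typing of function names: `FunTyping D nl nt F Ls As Bs A` is the judgment that
`F[L̄ Ā]` has type `B̄. A` in the presence of `nl` location and `nt` type variables. -/
inductive FunTyping (D : Decomp) (nl nt : ℕ) :
    FName → List Loc → List Ty → List Ty → Ty → Prop where
  | abs {F Ls As d A L B x M} :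
      D.at L F = some d → d.ty = .fn A L B → d.code = .lam x M →
      Ls.length = d.nl → As.length = d.nt →
      (∀ L' ∈ Ls, L'.WF nl) → (∀ A' ∈ As, A'.WF nl nt) →
      (∀ A' ∈ As, A'.Reloc) → (∀ B' ∈ d.Bs, B'.Reloc) →
      FunTyping D nl nt F Ls As
        (d.Bs.map (Ty.subst (ofList Loc.var Ls) (ofList Ty.var As)))
        (d.ty.subst (ofList Loc.var Ls) (ofList Ty.var As))
  | labs {F Ls As d A V} :
      D.common F = some d → d.ty = .allL A → d.code = .llam V →
      Ls.length = d.nl → As.length = d.nt →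
      (∀ L' ∈ Ls, L'.WF nl) → (∀ A' ∈ As, A'.WF nl nt) →
      (∀ A' ∈ As, A'.Reloc) → (∀ B' ∈ d.Bs, B'.Reloc) →
      FunTyping D nl nt F Ls As
        (d.Bs.map (Ty.subst (ofList Loc.var Ls) (ofList Ty.var As)))
        (d.ty.subst (ofList Loc.var Ls) (ofList Ty.var As))

/-- The part `x₁ : A₁, …, xₘ : Aₘ` of a typing environment; the most recent binding comes first. -/
abbrev Ctx := List (Name × Ty)

/-- `Typing D nl nt Γ L M A` is the judgment `Γ ⊢_L M : A`, where the environment consists of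
`nl` location variables, `nt` type variables and the bindings `Γ`. -/
inductive Typing (D : Decomp) : ℕ → ℕ → Ctx → Loc → Tm → Ty → Prop where
  | var {nl nt Γ L x A} :
      Γ.lookup x = some A → Typing D nl nt Γ L (.val (.var x)) A
  | letin {nl nt Γ L x M N A B} :
      Typing D nl nt Γ L M A → Typing D nl nt ((x, A) :: Γ) L N B →
      Typing D nl nt Γ L (.letin x M N) B
  | clo {nl nt Γ L Ws F Ls As Bs A} :
      FunTyping D nl nt F Ls As Bs A → Ws.length = Bs.length →
      (∀ p ∈ Ws.zip Bs, Typing D nl nt Γ L (.val p.1) p.2) →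
      Typing D nl nt Γ L (.val (.clo Ws F Ls As)) (.clo A)
  | proj1 {nl nt Γ L V A B} :
      Typing D nl nt Γ L (.val V) (.prod A B) → Typing D nl nt Γ L (.proj 0 V) A
  | proj2 {nl nt Γ L V A B} :
      Typing D nl nt Γ L (.val V) (.prod A B) → Typing D nl nt Γ L (.proj 1 V) B
  | pair {nl nt Γ L V W A B} :
      Typing D nl nt Γ L (.val V) A → Typing D nl nt Γ L (.val W) B →
      Typing D nl nt Γ L (.val (.pair V W)) (.prod A B)
  | tabs {nl nt Γ L V A} :
      (∀ L₀ : Loc, L₀.WF nl →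
        Typing D nl (nt + 1) (Γ.map fun p => (p.1, p.2.shiftT)) L₀ (.val (.unit V)) A) →
      Typing D nl nt Γ L (.val (.tabs V)) (.allT A)
  | tapp {nl nt Γ L V A B} :
      Typing D nl nt Γ L (.val V) (.allT A) → B.WF nl nt → B.Reloc →
      Typing D nl nt Γ L (.tapp V B) (A.instT B)
  | lapp {nl nt Γ L V A L'} :
      Typing D nl nt Γ L (.val V) (.clo (.allL A)) → L'.WF nl →
      Typing D nl nt Γ L (.lapp V L') (A.instL L')
  | unit {nl nt Γ L V A} :
      Typing D nl nt Γ L (.val V) A → A.Reloc →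
      Typing D nl nt Γ L (.val (.unit V)) (.T A)
  | bind {nl nt Γ L x M N A B} :
      Typing D nl nt Γ L M (.T A) → Typing D nl nt ((x, A) :: Γ) L N (.T B) →
      Typing D nl nt Γ L (.val (.bind x M N)) (.T B)
  | app {nl nt Γ L V W A B} :
      Typing D nl nt Γ L (.val V) (.clo (.fn A L B)) → Typing D nl nt Γ L (.val W) A →
      Typing D nl nt Γ L (.app V W) B
  | gen {nl nt Γ L L' V W A B} :
      Typing D nl nt Γ L (.val V) (.clo (.fn A L' (.T B))) → Typing D nl nt Γ L (.val W) A →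
      A.Reloc → L'.WF nl →
      Typing D nl nt Γ L (.val (.gen L' V W)) (.T B)
  | req {nl nt Γ V W A B} :
      Typing D nl nt Γ (.const .c) (.val V) (.clo (.fn A (.const .s) (.T B))) →
      Typing D nl nt Γ (.const .c) (.val W) A → A.Reloc →
      Typing D nl nt Γ (.const .c) (.val (.req V W)) (.T B)
  | call {nl nt Γ V W A B} :
      Typing D nl nt Γ (.const .s) (.val V) (.clo (.fn A (.const .c) (.T B))) →
      Typing D nl nt Γ (.const .s) (.val W) A → A.Reloc →
      Typing D nl nt Γ (.const .s) (.val (.call V W)) (.T B)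

/-- A binding `F : l̄ ᾱ. B̄. A = l̄ ᾱ. z̄. OpenCode` is well-typed and lies in the right part of the
decomposition. -/
inductive BindingOK (D : Decomp) (F : FName) (d : FunDef) : Prop where
  | abs {A L B x M} :
      d.ty = .fn A L B → d.code = .lam x M → D.at L F = some d →
      d.zs.length = d.Bs.length → (x :: d.zs).Nodup →
      d.ty.WF d.nl d.nt → (∀ B' ∈ d.Bs, B'.WF d.nl d.nt) →
      Typing D d.nl d.nt ((x, A) :: d.zs.zip d.Bs) L M B →
      BindingOK D F d
  | labs {A V} :
      d.ty = .allL A → d.code = .llam V → D.common F = some d →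
      d.zs.length = d.Bs.length → d.zs.Nodup →
      d.ty.WF d.nl d.nt → (∀ B' ∈ d.Bs, B'.WF d.nl d.nt) →
      (∀ L : Loc, L.WF (d.nl + 1) →
        Typing D (d.nl + 1) d.nt (d.zs.zip (d.Bs.map Ty.shiftL)) L (.val V) A) →
      BindingOK D F d

/-- The program `(Φ_c, Φ_s)` is well-formed through the decomposition `D`: the three parts have
disjoint sets of names, their union is `Φ_c ∪ Φ_s`, and every binding is well-typed. -/
structure Program.WF (P : Program) (D : Decomp) : Prop where
  disj_client_server : ∀ F, D.client F = none ∨ D.server F = none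
  disj_client_common : ∀ F, D.client F = none ∨ D.common F = none
  disj_server_common : ∀ F, D.server F = none ∨ D.common F = none
  union : ∀ F d, (P.client F = some d ∨ P.server F = some d) ↔
    (D.client F = some d ∨ D.server F = some d ∨ D.common F = some d)
  ok : ∀ F d, (P.client F = some d ∨ P.server F = some d) → BindingOK D F d

/-! ## The semantics of the polymorphic calculus -/

/-- Contexts `E_let`. -/
inductive ELet where
  | hole
  | letin (x : Name) (E : ELet) (M : Tm)

/-- Evaluation contexts `E`. -/
inductive ECtx where
  | ofLet (E : ELet)
  | bind (x : Name) (E : ECtx) (M : Tm)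

def ELet.plug : ELet → Tm → Tm
  | .hole, N => N
  | .letin x E M, N => .letin x (E.plug N) M

def ECtx.plug : ECtx → Tm → Tm
  | .ofLet E, N => E.plug N
  | .bind x E M, N => .val (.bind x (E.plug N) M)

abbrev Stack := List ECtx

/-- Configurations `⟨M;Δ_c | Δ_s⟩` and `⟨Δ_c | M;Δ_s⟩`. -/
inductive Conf where
  | client (M : Tm) (Δc Δs : Stack)
  | server (Δc : Stack) (M : Tm) (Δs : Stack)

/-- Local reduction with the function map `Φ`. -/
inductive LocalStep (Φ : FunMap) : Tm → Tm → Prop where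
  | letin {x V M} : LocalStep Φ (.letin x (.val V) M) (M.subst x V)
  | bind {x V M} : LocalStep Φ (.val (.bind x (.val (.unit V)) M)) (M.subst x V)
  | proj1 {V₁ V₂} : LocalStep Φ (.proj 0 (.pair V₁ V₂)) (.val V₁)
  | proj2 {V₁ V₂} : LocalStep Φ (.proj 1 (.pair V₁ V₂)) (.val V₂)
  | tapp {V A} : LocalStep Φ (.tapp (.tabs V) A) (.val (.unit (V.instT A)))
  | app {Ws F Ls As V zs x M} :
      Lookup Φ F Ls As zs (.lam x M) → Ws.length = zs.length →
      LocalStep Φ (.app (.clo Ws F Ls As) V) ((M.substs zs Ws).subst x V)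
  | lapp {Ws F Ls As b zs V} :
      Lookup Φ F Ls As zs (.llam V) → Ws.length = zs.length →
      LocalStep Φ (.lapp (.clo Ws F Ls As) (.const b)) (.val ((V.substs zs Ws).instL (.const b)))

/-- Reduction of configurations. -/
inductive Step (P : Program) : Conf → Conf → Prop where
  | localC {M M' E Δc Δs} :
      LocalStep P.client M M' →
      Step P (.client (ECtx.plug E M) Δc Δs) (.client (ECtx.plug E M') Δc Δs)
  | localS {M M' E Δc Δs} :
      LocalStep P.server M M' →
      Step P (.server Δc (ECtx.plug E M) Δs) (.server Δc (ECtx.plug E M') Δs)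
  | req {E V W Δc Δs} :
      Step P (.client (ECtx.plug E (.val (.req V W))) Δc Δs)
        (.server (E :: Δc) (.app V W) Δs)
  | call {E V W Δc Δs} :
      Step P (.server Δc (ECtx.plug E (.val (.call V W))) Δs)
        (.client (.app V W) Δc (E :: Δs))
  | unitC {V E Δc Δs} :
      Step P (.client (.val (.unit V)) Δc (E :: Δs))
        (.server Δc (E.plug (.val (.unit V))) Δs)
  | unitS {V E Δc Δs} :
      Step P (.server (E :: Δc) (.val (.unit V)) Δs)
        (.client (E.plug (.val (.unit V))) Δc Δs)
  | unitSE {V} :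
      Step P (.server [] (.val (.unit V)) []) (.client (.val (.unit V)) [] [])
  | genCC {E V W Δc Δs} :
      Step P (.client (ECtx.plug E (.val (.gen (.const .c) V W))) Δc Δs)
        (.client (ECtx.plug E (.app V W)) Δc Δs)
  | genSC {E V W Δc Δs} :
      Step P (.client (ECtx.plug E (.val (.gen (.const .s) V W))) Δc Δs)
        (.client (ECtx.plug E (.val (.req V W))) Δc Δs)
  | genCS {E V W Δc Δs} :
      Step P (.server Δc (ECtx.plug E (.val (.gen (.const .c) V W))) Δs)
        (.server Δc (ECtx.plug E (.val (.call V W))) Δs)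
  | genSS {E V W Δc Δs} :
      Step P (.server Δc (ECtx.plug E (.val (.gen (.const .s) V W))) Δs)
        (.server Δc (ECtx.plug E (.app V W)) Δs)

/-! ## The untyped calculus -/

/-- Variables of the untyped calculus: the term variables `x` of the polymorphic calculus, and a
variable `x_l` (also written `z_l`) for every location variable `l`. -/
inductive UVar where
  | tm (x : Name)
  | loc (l : ℕ)
deriving DecidableEq

/-- Data constructors; `Closure v̄ F` is the constructor `closure F` applied to `v̄`. -/
inductive Con where
  | client
  | server
  | apply
  | ret
  | closure (F : FName)
deriving DecidableEq

/-- Communication primitives. -/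
inductive Prim where
  | send
  | receive
deriving DecidableEq

mutual
  inductive UVal where
    | var (x : UVar)
    | pair (v w : UVal)
    | con (k : Con) (vs : List UVal)
    | unit (v : UVal)
    | bind (x : UVar) (m n : UTm)
    /-- `loop ()`. It stands for its body, which is a value of the form `do x ← receive; m`. -/
    | loop
  inductive UTm where
    | val (v : UVal)
    | letin (x : UVar) (m n : UTm)
    | proj (i : Fin 2) (v : UVal)
    | app (v w : UVal)
    | prim (p : Prim) (vs : List UVal)
    | case (v : UVal) (brs : Branches)
  /-- The branches `k₁ x̄₁ → m₁; …; kₙ x̄ₙ → mₙ` of a case term. -/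
  inductive Branches where
    | nil
    | cons (k : Con) (xs : List UVar) (m : UTm) (rest : Branches)
end

mutual
  def UVal.subst : UVal → UVar → UVal → UVal
    | .var y, x, u => if x = y then u else .var y
    | .pair v w, x, u => .pair (v.subst x u) (w.subst x u)
    | .con k vs, x, u => .con k (UVal.substList vs x u)
    | .unit v, x, u => .unit (v.subst x u)
    | .bind y m n, x, u => .bind y (m.subst x u) (if x = y then n else n.subst x u)
    | .loop, _, _ => .loop
  termination_by structural v => v
  def UVal.substList : List UVal → UVar → UVal → List UVal
    | [], _, _ => []
    | v :: vs, x, u => v.subst x u :: UVal.substList vs x u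
  def UTm.subst : UTm → UVar → UVal → UTm
    | .val v, x, u => .val (v.subst x u)
    | .letin y m n, x, u => .letin y (m.subst x u) (if x = y then n else n.subst x u)
    | .proj i v, x, u => .proj i (v.subst x u)
    | .app v w, x, u => .app (v.subst x u) (w.subst x u)
    | .prim p vs, x, u => .prim p (UVal.substList vs x u)
    | .case v brs, x, u => .case (v.subst x u) (brs.subst x u)
  def Branches.subst : Branches → UVar → UVal → Branches
    | .nil, _, _ => .nil
    | .cons k xs m rest, x, u =>
        .cons k xs (if x ∈ xs then m else m.subst x u) (rest.subst x u)
end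

/-- `m{v̄/x̄}` -/
def UTm.substs (m : UTm) (xs : List UVar) (vs : List UVal) : UTm :=
  (xs.zip vs).foldl (fun n p => n.subst p.1 p.2) m

/-- The variable `x` is not used in `m`. -/
def UTm.Unused (x : UVar) (m : UTm) : Prop := ∀ v, m.subst x v = m

/-- The branch for a constructor. -/
def Branches.find (k : Con) : Branches → Option (List UVar × UTm)
  | .nil => none
  | .cons k' xs m rest => if k = k' then some (xs, m) else rest.find k

/-- Untyped codes `z̄. λ x. m`. -/
structure UFun where
  zs : List UVar
  x : UVar
  body : UTm

abbrev UFunMap := FName → Option UFun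

structure UProgram where
  client : UFunMap
  server : UFunMap

/-- `do send v; m` -/
def sendThen (v : UVal) (m : UTm) : UVal := .bind (.tm 0) (.prim .send [v]) m

/-- The term after `do x ← receive` in the body of `loop`, where `x` is `UVar.tm 0`:
`case x of { Apply f arg → do z ← f(arg); do send (Ret z); loop (); Ret y → unit y }`. -/
def loopCase : UTm :=
  .case (.var (.tm 0))
    (.cons .apply [.tm 1, .tm 2]
      (.val (.bind (.tm 3) (.app (.var (.tm 1)) (.var (.tm 2)))
        (.val (sendThen (.con .ret [.var (.tm 3)]) (.val .loop)))))
    (.cons .ret [.tm 4] (.val (.unit (.var (.tm 4))))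
    .nil))

/-- `Receives w x m`: the value `w` is `do x ← receive; m`, where `loop ()` is identified with
its body. -/
inductive Receives : UVal → UVar → UTm → Prop where
  | receive {x m} : Receives (.bind x (.prim .receive []) m) x m
  | loop : Receives .loop (.tm 0) loopCase

/-- Contexts `e_let`. -/
inductive UELet where
  | hole
  | letin (x : UVar) (e : UELet) (m : UTm)

/-- Evaluation contexts `e`. -/
inductive UECtx where
  | ofLet (e : UELet)
  | bind (x : UVar) (e : UECtx) (m : UTm)

def UELet.plug : UELet → UTm → UTm
  | .hole, n => n
  | .letin x e m, n => .letin x (e.plug n) m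

def UECtx.plug : UECtx → UTm → UTm
  | .ofLet e, n => e.plug n
  | .bind x e m, n => .val (.bind x (e.plug n) m)

/-- Configurations `⟨m_c | m_s⟩`. -/
structure UConf where
  client : UTm
  server : UTm

/-- Local reduction with the function map `φ`. -/
inductive ULocalStep (φ : UFunMap) : UTm → UTm → Prop where
  | letin {x v m} : ULocalStep φ (.letin x (.val v) m) (m.subst x v)
  | bind {x v m} : ULocalStep φ (.val (.bind x (.val (.unit v)) m)) (m.subst x v)
  | proj1 {v₁ v₂} : ULocalStep φ (.proj 0 (.pair v₁ v₂)) (.val v₁)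
  | proj2 {v₁ v₂} : ULocalStep φ (.proj 1 (.pair v₁ v₂)) (.val v₂)
  | app {F f ws v} :
      φ F = some f → ws.length = f.zs.length →
      ULocalStep φ (.app (.con (.closure F) ws) v) ((f.body.substs f.zs ws).subst f.x v)
  | case {k vs brs xs m} :
      brs.find k = some (xs, m) → vs.length = xs.length →
      ULocalStep φ (.case (.con k vs) brs) (m.substs xs vs)

/-- Reduction of configurations: one side takes a local step while the other side is waiting to
receive, or one side sends a value to the other side. -/
inductive UStep (p : UProgram) : UConf → UConf → Prop where
  | localC {m m' e₁ e₂ w x n} :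
      ULocalStep p.client m m' → Receives w x n →
      UStep p ⟨UECtx.plug e₁ m, UECtx.plug e₂ (.val w)⟩ ⟨UECtx.plug e₁ m', UECtx.plug e₂ (.val w)⟩
  | localS {m m' e₁ e₂ w x n} :
      ULocalStep p.server m m' → Receives w x n →
      UStep p ⟨UECtx.plug e₁ (.val w), UECtx.plug e₂ m⟩ ⟨UECtx.plug e₁ (.val w), UECtx.plug e₂ m'⟩
  | commCS {e₁ e₂ y v m₁ w x m₂} :
      UTm.Unused y m₁ → Receives w x m₂ →
      UStep p
        ⟨UECtx.plug e₁ (.val (.bind y (.prim .send [v]) m₁)), UECtx.plug e₂ (.val w)⟩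
        ⟨UECtx.plug e₁ m₁, UECtx.plug e₂ (m₂.subst x v)⟩
  | commSC {e₁ e₂ y v m₁ w x m₂} :
      Receives w x m₁ → UTm.Unused y m₂ →
      UStep p
        ⟨UECtx.plug e₁ (.val w), UECtx.plug e₂ (.val (.bind y (.prim .send [v]) m₂))⟩
        ⟨UECtx.plug e₁ (m₁.subst x v), UECtx.plug e₂ m₂⟩

/-! ## The compilation -/

/-- `⟦L⟧` -/
def Loc.comp : Loc → UVal
  | .const .c => .con .client []
  | .const .s => .con .server []
  | .var l => .var (.loc l)

/-- `if(v, m₁, m₂)` -/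
def ifClient (v : UVal) (m₁ m₂ : UTm) : UTm :=
  .case v (.cons .client [] m₁ (.cons .server [] m₂ .nil))

/-- `do x ← m; unit x` -/
def bindUnit (m : UTm) : UVal := .bind (.tm 0) m (.val (.unit (.var (.tm 0))))

/-- `do send (Apply v w); loop ()`, the compilation of `req(V, W)` and `call(V, W)`. -/
def remoteCall (v w : UVal) : UVal := sendThen (.con .apply [v, w]) (.val .loop)

/-- The compilation of `gen(L, V, W)` at a location, from the compilations of `L`, `V`, `W`. -/
def genCall : Side → UVal → UVal → UVal → UVal
  | .c, l, v, w => bindUnit (ifClient l (.app v w) (.val (remoteCall v w)))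
  | .s, l, v, w => bindUnit (ifClient l (.val (remoteCall v w)) (.app v w))

mutual
  /-- `⟦V⟧_a` -/
  def Val.comp (a : Side) : Val → UVal
    | .var x => .var (.tm x)
    | .pair V W => .pair (V.comp a) (W.comp a)
    | .clo Ws F Ls _ => .con (.closure F) (Ls.map Loc.comp ++ Val.compList a Ws)
    | .tabs V => V.comp a
    | .unit V => .unit (V.comp a)
    | .bind x M N => .bind (.tm x) (M.comp a) (N.comp a)
    | .req V W => remoteCall (V.comp a) (W.comp a)
    | .call V W => remoteCall (V.comp a) (W.comp a)
    | .gen L V W => genCall a L.comp (V.comp a) (W.comp a)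
  def Val.compList (a : Side) : List Val → List UVal
    | [] => []
    | V :: Vs => V.comp a :: Val.compList a Vs
  /-- `⟦M⟧_a` -/
  def Tm.comp (a : Side) : Tm → UTm
    | .val V => .val (V.comp a)
    | .letin x M N => .letin (.tm x) (M.comp a) (N.comp a)
    | .proj i V => .proj i (V.comp a)
    | .app V W => .app (V.comp a) (W.comp a)
    | .tapp V _ => .val (.unit (V.comp a))
    | .lapp V L => .app (V.comp a) L.comp
end

/-- `⟦l̄ ᾱ. z̄. OpenCode⟧_a = z̄_l z̄. ⟦OpenCode⟧_a`. In `Λ l. V` the variable `l` has index `0`,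
and the variables `l̄` have the indices `1, …, nl`. -/
def FunDef.comp (a : Side) (d : FunDef) : UFun :=
  match d.code with
  | .lam x M =>
      { zs := (List.range d.nl).map UVar.loc ++ d.zs.map UVar.tm
        x := .tm x
        body := M.comp a }
  | .llam V =>
      { zs := (List.range d.nl).map (fun i => UVar.loc (i + 1)) ++ d.zs.map UVar.tm
        x := .loc 0
        body := .val (V.comp a) }

/-- `⟦Φ_c, Φ_s⟧ = ⟦Φ_c⟧_c, ⟦Φ_s⟧_s` -/
def Program.comp (P : Program) : UProgram where
  client F := (P.client F).map (FunDef.comp .c)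
  server F := (P.server F).map (FunDef.comp .s)

end LamCS

/-!
A source reduction cannot be simulated step by step: below a `let` the source runs `gen`, whereas
its compilation `do x ← case …; unit x` is a value there. So reduction is first turned into big-step
evaluation, where a monadic value reached by a term is kept as it is and only run where its result
is demanded (`Ev`, `RunVal`, `Run`). Backwards along a step, the evaluation then meets monadic
values that the reduction has run too early. The relation `Forced` compares terms up to such
replacements, and evaluation respects it. Results have relocatable types, so they contain no
monadic values, and for them `Forced` is equality.

Big-step evaluation is simulated by the compiled program inside every stack of continuations, the
other side being in `loop ()`. A value of relocatable type has the same compilation at both sides,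
so it can be sent.
-/

namespace LamCS

/-! ### Substitution of locations and types -/

namespace Loc

@[simp] theorem ren_id (L : Loc) : L.ren id = L := by cases L <;> rfl

@[simp] theorem subst_var (L : Loc) : L.subst var = L := by cases L <;> rfl

theorem ren_eq_subst (L : Loc) (ρ : ℕ → ℕ) : L.ren ρ = L.subst fun i => var (ρ i) := by
  cases L <;> rfl

theorem ren_subst (L : Loc) (ρ : ℕ → ℕ) (σ : ℕ → Loc) :
    (L.ren ρ).subst σ = L.subst fun i => σ (ρ i) := by
  cases L <;> rfl

theorem subst_ren (L : Loc) (σ : ℕ → Loc) (ρ : ℕ → ℕ) :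
    (L.subst σ).ren ρ = L.subst fun i => (σ i).ren ρ := by
  cases L <;> rfl

theorem subst_subst (L : Loc) (σ τ : ℕ → Loc) :
    (L.subst σ).subst τ = L.subst fun i => (σ i).subst τ := by
  cases L <;> rfl

theorem subst_congr {L : Loc} {nl : ℕ} {σ σ' : ℕ → Loc} (hL : L.WF nl)
    (h : ∀ i < nl, σ i = σ' i) : L.subst σ = L.subst σ' := by
  cases L with
  | const a => rfl
  | var i => exact h i hL

theorem WF.subst {L : Loc} {nl nl' : ℕ} {σ : ℕ → Loc} (hL : L.WF nl)
    (h : ∀ i < nl, (σ i).WF nl') : (L.subst σ).WF nl' := by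
  cases L with
  | const a => trivial
  | var i => exact h i hL

theorem WF.mono {L : Loc} {nl nl' : ℕ} (hL : L.WF nl) (h : nl ≤ nl') : L.WF nl' := by
  cases L with
  | const a => trivial
  | var i => exact lt_of_lt_of_le (show i < nl from hL) h

theorem WF.ren_succ {L : Loc} {nl : ℕ} (hL : L.WF nl) : (L.ren Nat.succ).WF (nl + 1) := by
  cases L with
  | const a => trivial
  | var i => exact Nat.succ_lt_succ hL

end Loc

section OfList

variable {α β : Type} (v : ℕ → α) (as : List α)

theorem ofList_of_lt {i : ℕ} (h : i < as.length) : ofList v as i = as[i] := by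
  simp [ofList, h]

@[simp] theorem ofList_singleton_succ (a : α) (i : ℕ) : ofList v [a] (i + 1) = v i := by
  simp [ofList]

theorem ofList_map {i : ℕ} (h : i < as.length) (w : ℕ → β) (f : α → β) :
    ofList w (as.map f) i = f (ofList v as i) := by
  simp [ofList, h]

variable {v as}

theorem ofList_forall_lt {p : α → Prop} (has : ∀ a ∈ as, p a) :
    ∀ i < as.length, p (ofList v as i) :=
  fun _ hi => ofList_of_lt v as hi ▸ has _ (List.getElem_mem hi)

theorem ofList_forall {p : α → Prop} (hv : ∀ i, p (v i)) (has : ∀ a ∈ as, p a) (i : ℕ) :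
    p (ofList v as i) := by
  rcases lt_or_ge i as.length with hi | hi
  · exact ofList_forall_lt has i hi
  · simpa [ofList, hi] using hv _

end OfList

theorem liftL_var : liftL Loc.var = Loc.var := by
  funext i; cases i <;> rfl

theorem locVar_liftRen (ρ : ℕ → ℕ) :
    (fun i => Loc.var (liftRen ρ i)) = liftL fun i => .var (ρ i) := by
  funext i; cases i <;> rfl

theorem liftL_liftRen (σ : ℕ → Loc) (ρ : ℕ → ℕ) :
    (fun i => liftL σ (liftRen ρ i)) = liftL fun i => σ (ρ i) := by
  funext i; cases i <;> rfl

theorem liftL_ren_liftRen (σ : ℕ → Loc) (ρ : ℕ → ℕ) :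
    (fun i => (liftL σ i).ren (liftRen ρ)) = liftL fun i => (σ i).ren ρ := by
  funext i
  cases i with
  | zero => rfl
  | succ i => simp only [liftL, Loc.ren_eq_subst, Loc.subst_subst]; rfl

theorem liftL_subst_liftL (σ τ : ℕ → Loc) :
    (fun i => (liftL σ i).subst (liftL τ)) = liftL fun i => (σ i).subst τ := by
  funext i
  cases i with
  | zero => rfl
  | succ i => simp only [liftL, Loc.ren_subst, Loc.subst_ren]

theorem liftL_congr {n : ℕ} {σ σ' : ℕ → Loc} (h : ∀ i < n, σ i = σ' i) :
    ∀ i < n + 1, liftL σ i = liftL σ' i :=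
  Nat.forall_lt_succ_left.mpr ⟨rfl, fun i hi => congrArg (Loc.ren Nat.succ) (h i hi)⟩

theorem liftL_wf {n n' : ℕ} {σ : ℕ → Loc} (h : ∀ i < n, (σ i).WF n') :
    ∀ i < n + 1, (liftL σ i).WF (n' + 1) :=
  Nat.forall_lt_succ_left.mpr ⟨Nat.succ_pos _, fun i hi => (h i hi).ren_succ⟩

namespace Ty

theorem liftT_var : liftT var = var := by
  funext i; cases i <;> rfl

theorem tyVar_liftRen (ρ : ℕ → ℕ) : (fun i => var (liftRen ρ i)) = liftT fun i => var (ρ i) := by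
  funext i; cases i <;> rfl

theorem liftT_liftRen (σ : ℕ → Ty) (ρ : ℕ → ℕ) :
    (fun i => liftT σ (liftRen ρ i)) = liftT fun i => σ (ρ i) := by
  funext i; cases i <;> rfl

theorem ren_eq_subst (A : Ty) (ρl ρt : ℕ → ℕ) :
    A.ren ρl ρt = A.subst (fun i => .var (ρl i)) (fun i => .var (ρt i)) := by
  induction A generalizing ρl ρt with
  | base | var => rfl
  | fn A L B ihA ihB => simp only [ren, subst, ihA, ihB, Loc.ren_eq_subst]
  | clo _ ih | T _ ih => simp only [ren, subst, ih]
  | prod A B ihA ihB => simp only [ren, subst, ihA, ihB]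
  | allT A ih => simp only [ren, subst, ih, tyVar_liftRen]
  | allL A ih => simp only [ren, subst, ih, locVar_liftRen]; rfl

theorem ren_subst (A : Ty) (ρl ρt : ℕ → ℕ) (σl : ℕ → Loc) (σt : ℕ → Ty) :
    (A.ren ρl ρt).subst σl σt = A.subst (fun i => σl (ρl i)) (fun i => σt (ρt i)) := by
  induction A generalizing ρl ρt σl σt with
  | base | var => rfl
  | fn A L B ihA ihB => simp only [ren, subst, ihA, ihB, Loc.ren_subst]
  | clo _ ih | T _ ih => simp only [ren, subst, ih]
  | prod A B ihA ihB => simp only [ren, subst, ihA, ihB]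
  | allT A ih => simp only [ren, subst, ih, liftT_liftRen]
  | allL A ih => simp only [ren, subst, ih, liftL_liftRen]

theorem ren_ren (A : Ty) (ρl ρt ρl' ρt' : ℕ → ℕ) :
    (A.ren ρl ρt).ren ρl' ρt' = A.ren (fun i => ρl' (ρl i)) (fun i => ρt' (ρt i)) := by
  rw [ren_eq_subst, ren_subst, ren_eq_subst A]

theorem liftT_ren_liftRen (σ : ℕ → Ty) (ρl ρt : ℕ → ℕ) :
    (fun i => (liftT σ i).ren ρl (liftRen ρt)) = liftT fun i => (σ i).ren ρl ρt := by
  funext i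
  cases i with
  | zero => rfl
  | succ i => simp only [liftT, shiftT, ren_ren]; rfl

theorem subst_ren (A : Ty) (σl : ℕ → Loc) (σt : ℕ → Ty) (ρl ρt : ℕ → ℕ) :
    (A.subst σl σt).ren ρl ρt
      = A.subst (fun i => (σl i).ren ρl) (fun i => (σt i).ren ρl ρt) := by
  induction A generalizing ρl ρt σl σt with
  | base | var => rfl
  | fn A L B ihA ihB => simp only [ren, subst, ihA, ihB, Loc.subst_ren]
  | clo _ ih | T _ ih => simp only [ren, subst, ih]
  | prod A B ihA ihB => simp only [ren, subst, ihA, ihB]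
  | allT A ih => simp only [ren, subst, ih, liftT_ren_liftRen]
  | allL A ih => simp only [ren, subst, ih, liftL_ren_liftRen, shiftL, ren_ren]; rfl

theorem shiftT_subst (A : Ty) (σl : ℕ → Loc) (σt : ℕ → Ty) :
    A.shiftT.subst σl (liftT σt) = (A.subst σl σt).shiftT := by
  simp only [shiftT, ren_subst, subst_ren, Loc.ren_id]; rfl

theorem shiftL_subst (A : Ty) (σl : ℕ → Loc) (σt : ℕ → Ty) :
    A.shiftL.subst (liftL σl) (fun i => (σt i).shiftL) = (A.subst σl σt).shiftL := by
  simp only [shiftL, ren_subst, subst_ren]; rfl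

theorem liftT_subst_liftT (σ : ℕ → Ty) (τl : ℕ → Loc) (τt : ℕ → Ty) :
    (fun i => (liftT σ i).subst τl (liftT τt)) = liftT fun i => (σ i).subst τl τt := by
  funext i
  cases i with
  | zero => rfl
  | succ i => simp only [liftT, shiftT_subst]

theorem subst_subst (A : Ty) (σl τl : ℕ → Loc) (σt τt : ℕ → Ty) :
    (A.subst σl σt).subst τl τt
      = A.subst (fun i => (σl i).subst τl) (fun i => (σt i).subst τl τt) := by
  induction A generalizing σl τl σt τt with
  | base | var => rfl
  | fn A L B ihA ihB => simp only [subst, ihA, ihB, Loc.subst_subst]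
  | clo _ ih | T _ ih => simp only [subst, ih]
  | prod A B ihA ihB => simp only [subst, ihA, ihB]
  | allT A ih => simp only [subst, ih, liftT_subst_liftT]
  | allL A ih => simp only [subst, ih, liftL_subst_liftL, shiftL_subst]

@[simp] theorem subst_var (A : Ty) : A.subst Loc.var var = A := by
  induction A with
  | base | var => rfl
  | fn A L B ihA ihB => simp only [subst, ihA, ihB, Loc.subst_var]
  | clo _ ih | T _ ih => simp only [subst, ih]
  | prod A B ihA ihB => simp only [subst, ihA, ihB]
  | allT A ih => simp only [subst, liftT_var, ih]
  | allL A ih =>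
    have hvar : (fun i => (var i).shiftL) = var := rfl
    simp only [subst, liftL_var, hvar, ih]

theorem liftT_congr {n : ℕ} {σ σ' : ℕ → Ty} (h : ∀ i < n, σ i = σ' i) :
    ∀ i < n + 1, liftT σ i = liftT σ' i :=
  Nat.forall_lt_succ_left.mpr ⟨rfl, fun i hi => congrArg shiftT (h i hi)⟩

theorem liftT_eq_var {n : ℕ} {σ : ℕ → Ty} (h : ∀ i < n, σ i = var i) :
    ∀ i < n + 1, liftT σ i = var i := by
  simpa only [liftT_var] using liftT_congr h

theorem subst_congr {A : Ty} {nl nt : ℕ} {σl σl' : ℕ → Loc} {σt σt' : ℕ → Ty} (hA : A.WF nl nt)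
    (hl : ∀ i < nl, σl i = σl' i) (ht : ∀ i < nt, σt i = σt' i) :
    A.subst σl σt = A.subst σl' σt' := by
  induction A generalizing nl nt σl σl' σt σt' with
  | base => rfl
  | var i => exact ht i hA
  | fn A L B ihA ihB =>
    simp only [subst, ihA hA.1 hl ht, ihB hA.2.2 hl ht, Loc.subst_congr hA.2.1 hl]
  | clo _ ih => exact congrArg clo (ih hA hl ht)
  | T _ ih => exact congrArg T (ih hA hl ht)
  | prod A B ihA ihB => exact congrArg₂ prod (ihA hA.1 hl ht) (ihB hA.2 hl ht)
  | allT A ih => exact congrArg allT (ih hA hl (liftT_congr ht))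
  | allL A ih =>
    exact congrArg allL (ih hA (liftL_congr hl) fun i hi => congrArg shiftL (ht i hi))

theorem subst_eq_self {A : Ty} {nl nt : ℕ} {σl : ℕ → Loc} {σt : ℕ → Ty} (hA : A.WF nl nt)
    (hl : ∀ i < nl, σl i = .var i) (ht : ∀ i < nt, σt i = .var i) : A.subst σl σt = A := by
  rw [subst_congr hA hl ht, subst_var]

theorem ren_eq_self {A : Ty} (hA : A.WF 0 0) (ρl ρt : ℕ → ℕ) : A.ren ρl ρt = A := by
  rw [ren_eq_subst]
  exact subst_eq_self hA (by simp) (by simp)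

theorem WF.mono {A : Ty} {nl nt nl' nt' : ℕ} (hA : A.WF nl nt) (hl : nl ≤ nl') (ht : nt ≤ nt') :
    A.WF nl' nt' := by
  induction A generalizing nl nt nl' nt' with
  | base => trivial
  | var i => exact lt_of_lt_of_le (show i < nt from hA) ht
  | fn A L B ihA ihB => exact ⟨ihA hA.1 hl ht, hA.2.1.mono hl, ihB hA.2.2 hl ht⟩
  | clo _ ih | T _ ih => exact ih (nl := nl) (nt := nt) hA hl ht
  | prod A B ihA ihB => exact ⟨ihA hA.1 hl ht, ihB hA.2 hl ht⟩
  | allT A ih => exact ih (nt := nt + 1) hA hl (Nat.succ_le_succ ht)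
  | allL A ih => exact ih (nl := nl + 1) hA (Nat.succ_le_succ hl) ht

theorem WF.ren {A : Ty} {nl nt nl' nt' : ℕ} {ρl ρt : ℕ → ℕ} (hA : A.WF nl nt)
    (hl : ∀ i < nl, ρl i < nl') (ht : ∀ i < nt, ρt i < nt') : (A.ren ρl ρt).WF nl' nt' := by
  have liftRen_lt {n n' : ℕ} {ρ : ℕ → ℕ} (h : ∀ i < n, ρ i < n') :
      ∀ i < n + 1, liftRen ρ i < n' + 1 :=
    Nat.forall_lt_succ_left.mpr ⟨Nat.succ_pos _, fun i hi => Nat.succ_lt_succ (h i hi)⟩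
  induction A generalizing nl nt nl' nt' ρl ρt with
  | base => trivial
  | var i => exact ht i hA
  | fn A L B ihA ihB =>
    exact ⟨ihA hA.1 hl ht, Loc.ren_eq_subst L ρl ▸ hA.2.1.subst hl, ihB hA.2.2 hl ht⟩
  | clo _ ih | T _ ih => exact ih (nl := nl) (nt := nt) hA hl ht
  | prod A B ihA ihB => exact ⟨ihA hA.1 hl ht, ihB hA.2 hl ht⟩
  | allT A ih => exact ih (nt := nt + 1) hA hl (liftRen_lt ht)
  | allL A ih => exact ih (nl := nl + 1) hA (liftRen_lt hl) ht

theorem WF.shiftT {A : Ty} {nl nt : ℕ} (hA : A.WF nl nt) : A.shiftT.WF nl (nt + 1) :=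
  hA.ren (fun _ => id) fun _ => Nat.succ_lt_succ

theorem WF.shiftL {A : Ty} {nl nt : ℕ} (hA : A.WF nl nt) : A.shiftL.WF (nl + 1) nt :=
  hA.ren (fun _ => Nat.succ_lt_succ) fun _ => id

theorem liftT_wf {nl n n' : ℕ} {σ : ℕ → Ty} (h : ∀ i < n, (σ i).WF nl n') :
    ∀ i < n + 1, (liftT σ i).WF nl (n' + 1) :=
  Nat.forall_lt_succ_left.mpr ⟨Nat.succ_pos _, fun i hi => (h i hi).shiftT⟩

theorem WF.subst {A : Ty} {nl nt nl' nt' : ℕ} {σl : ℕ → Loc} {σt : ℕ → Ty} (hA : A.WF nl nt)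
    (hl : ∀ i < nl, (σl i).WF nl') (ht : ∀ i < nt, (σt i).WF nl' nt') :
    (A.subst σl σt).WF nl' nt' := by
  induction A generalizing nl nt nl' nt' σl σt with
  | base => trivial
  | var i => exact ht i hA
  | fn A L B ihA ihB => exact ⟨ihA hA.1 hl ht, hA.2.1.subst hl, ihB hA.2.2 hl ht⟩
  | clo _ ih | T _ ih => exact ih (nl := nl) (nt := nt) hA hl ht
  | prod A B ihA ihB => exact ⟨ihA hA.1 hl ht, ihB hA.2 hl ht⟩
  | allT A ih => exact ih (nt := nt + 1) hA hl (liftT_wf ht)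
  | allL A ih => exact ih (nl := nl + 1) hA (liftL_wf hl) fun i hi => (ht i hi).shiftL

theorem Reloc.subst {A : Ty} {σl : ℕ → Loc} {σt : ℕ → Ty} (hA : A.Reloc)
    (h : ∀ i, (σt i).Reloc) : (A.subst σl σt).Reloc := by
  induction A with
  | base | clo | allT => trivial
  | var i => exact h i
  | fn | T | allL => exact hA.elim
  | prod A B ihA ihB => exact ⟨ihA hA.1, ihB hA.2⟩

theorem Reloc.ren {A : Ty} (hA : A.Reloc) (ρl ρt : ℕ → ℕ) : (A.ren ρl ρt).Reloc := by
  rw [ren_eq_subst]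
  exact hA.subst fun _ => trivial

theorem liftT_reloc {σ : ℕ → Ty} (h : ∀ i, (σ i).Reloc) : ∀ i, (liftT σ i).Reloc
  | 0 => trivial
  | i + 1 => (h i).ren _ _

theorem instT_subst (A B : Ty) (σl : ℕ → Loc) (σt : ℕ → Ty) :
    (A.instT B).subst σl σt = (A.subst σl (liftT σt)).instT (B.subst σl σt) := by
  simp only [instT, subst_subst, Loc.subst_var]
  congr 1
  funext i
  cases i with
  | zero => rfl
  | succ i =>
    simp only [ofList_singleton_succ, liftT, shiftT, ren_subst, subst]
    exact (subst_var _).symm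

theorem instL_subst (A : Ty) (L : Loc) (σl : ℕ → Loc) (σt : ℕ → Ty) :
    (A.instL L).subst σl σt
      = (A.subst (liftL σl) (fun i => (σt i).shiftL)).instL (L.subst σl) := by
  simp only [instL, subst_subst]
  congr 1 <;> funext i
  · cases i with
    | zero => rfl
    | succ i =>
      simp only [liftL, Loc.ren_subst, ofList_singleton_succ, Loc.subst_var]
      rfl
  · simp only [shiftL, ren_subst, subst, ofList_singleton_succ]
    exact (subst_var _).symm

theorem subst_ofList {A : Ty} {Ls : List Loc} {As : List Ty} (hA : A.WF Ls.length As.length)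
    (σl : ℕ → Loc) (σt : ℕ → Ty) :
    (A.subst (ofList Loc.var Ls) (ofList var As)).subst σl σt
      = A.subst (ofList Loc.var (Ls.map (Loc.subst σl))) (ofList var (As.map (subst σl σt))) := by
  rw [subst_subst]
  exact subst_congr hA (fun i hi => (ofList_map Loc.var Ls hi _ _).symm)
    fun i hi => (ofList_map var As hi _ _).symm

end Ty
/-! ### Typing environments -/

theorem Val.substList_eq_map (Vs : List Val) (x : Name) (U : Val) :
    Val.substList Vs x U = Vs.map fun V => V.subst x U := by
  induction Vs with
  | nil => rfl
  | cons V Vs ih => simp only [Val.substList, ih, List.map_cons]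

theorem Val.instList_eq_map (σl : ℕ → Loc) (σt : ℕ → Ty) (Vs : List Val) :
    Val.instList σl σt Vs = Vs.map (Val.inst σl σt) := by
  induction Vs with
  | nil => rfl
  | cons V Vs ih => simp only [Val.instList, ih, List.map_cons]

theorem forall_mem_zip_map_left {α β γ : Type} {f : α → γ} {as : List α} {bs : List β}
    {p : γ → β → Prop} (h : ∀ q ∈ as.zip bs, p (f q.1) q.2) :
    ∀ q ∈ (as.map f).zip bs, p q.1 q.2 := by
  intro q hq
  rw [List.zip_map_left, List.mem_map] at hq
  obtain ⟨r, hr, rfl⟩ := hq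
  exact h r hr

theorem exists_mem_zip_of_mem_left {α β : Type} {as : List α} {bs : List β}
    (hlen : as.length = bs.length) {a : α} (ha : a ∈ as) : ∃ b, (a, b) ∈ as.zip bs := by
  rw [← List.map_fst_zip hlen.le, List.mem_map] at ha
  obtain ⟨⟨_, b⟩, hab, rfl⟩ := ha
  exact ⟨b, hab⟩

theorem lookup_zip_eq_none {α : Type} {ks : List ℕ} {k : ℕ} (as : List α) (h : k ∉ ks) :
    (ks.zip as).lookup k = none := by
  refine List.lookup_eq_none_iff.mpr fun p hp => bne_iff_ne.mpr ?_
  rintro rfl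
  exact h (List.of_mem_zip hp).1

namespace Ctx

variable {Γ Γ' : Ctx} {x y : Name} {A B : Ty}

/-- Apply a map to all types of a typing environment. -/
abbrev mapTy (f : Ty → Ty) (Γ : Ctx) : Ctx := Γ.map fun p => (p.1, f p.2)

theorem lookup_cons (Γ : Ctx) (x y : Name) (B : Ty) :
    List.lookup x ((y, B) :: Γ) = if x = y then some B else List.lookup x Γ := by
  by_cases h : x = y
  · rw [h, List.lookup_cons_self, if_pos rfl]
  · rw [List.lookup_cons, beq_eq_false_iff_ne.mpr h, if_neg h]

theorem lookup_mapTy (f : Ty → Ty) (Γ : Ctx) (x : Name) :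
    (Γ.mapTy f).lookup x = (Γ.lookup x).map f := by
  induction Γ with
  | nil => rfl
  | cons p Γ ih =>
    rw [mapTy, List.map_cons, lookup_cons, lookup_cons, ih]
    split <;> rfl

theorem lookup_append (Γ Γ' : Ctx) (x : Name) :
    (Γ ++ Γ').lookup x = (Γ.lookup x).or (Γ'.lookup x) := by
  induction Γ with
  | nil => rfl
  | cons p Γ ih =>
    rw [List.cons_append, lookup_cons, lookup_cons, ih]
    split <;> rfl

theorem mapTy_zip (f : Ty → Ty) (zs : List Name) (Bs : List Ty) :
    mapTy f (zs.zip Bs) = zs.zip (Bs.map f) :=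
  (List.zip_map_right ..).symm

/-- Inclusion of typing environments, regarded as finite maps. -/
def Sub (Γ Γ' : Ctx) : Prop := ∀ x A, Γ.lookup x = some A → Γ'.lookup x = some A

namespace Sub

theorem refl (Γ : Ctx) : Γ.Sub Γ := fun _ _ => id

theorem nil (Γ : Ctx) : Sub [] Γ := fun _ _ h => nomatch h

theorem trans {Γ'' : Ctx} (h : Γ.Sub Γ') (h' : Γ'.Sub Γ'') : Γ.Sub Γ'' :=
  fun x A hx => h' x A (h x A hx)

theorem cons (h : Γ.Sub Γ') (y : Name) (B : Ty) : Sub ((y, B) :: Γ) ((y, B) :: Γ') := by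
  intro x A hx
  rw [lookup_cons] at hx ⊢
  split <;> rename_i hxy <;> simp only [hxy, if_true, if_false] at hx
  exacts [hx, h x A hx]

theorem mapTy (h : Γ.Sub Γ') (f : Ty → Ty) : (Γ.mapTy f).Sub (Γ'.mapTy f) := by
  intro x A hx
  rw [lookup_mapTy, Option.map_eq_some_iff] at hx ⊢
  exact hx.imp fun B hB => ⟨h x B hB.1, hB.2⟩

theorem shadow (Γ : Ctx) (y : Name) (A B : Ty) : Sub ((y, A) :: (y, B) :: Γ) ((y, A) :: Γ) := by
  intro x C hx
  simp only [lookup_cons] at hx ⊢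
  split <;> simp_all

theorem swap (Γ : Ctx) (hxy : x ≠ y) (A B : Ty) :
    Sub ((x, A) :: (y, B) :: Γ) ((y, B) :: (x, A) :: Γ) := by
  intro z C hz
  simp only [lookup_cons] at hz ⊢
  by_cases hx : z = x <;> by_cases hy : z = y <;> simp_all

theorem cons_append (hx : Γ.lookup x = none) (A : Ty) : Sub ((x, A) :: Γ) (Γ ++ [(x, A)]) := by
  intro y B hy
  rw [lookup_cons] at hy
  rw [lookup_append]
  split at hy <;> rename_i hyx
  · subst hyx
    rw [hx, Option.none_or, lookup_cons, if_pos rfl]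
    exact hy
  · rw [hy]; rfl

end Sub

theorem forall_lookup_cons {p : Ty → Prop} (hΓ : ∀ x A, Γ.lookup x = some A → p A) (hB : p B) :
    ∀ x A, List.lookup x ((y, B) :: Γ) = some A → p A := by
  intro x A h
  rw [lookup_cons] at h
  split at h
  · exact Option.some.inj h ▸ hB
  · exact hΓ x A h

end Ctx

/-! ### Instantiations and function names -/

/-- `(σl, σt)` maps the type and location variables of an environment with `nl` location and `nt`
type variables to well-formed locations and types of an environment with `nl'` and `nt'` such
variables, and the types are relocatable, as the typing rules demand of type arguments. -/
structure IsInst (nl nt nl' nt' : ℕ) (σl : ℕ → Loc) (σt : ℕ → Ty) : Prop where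
  locs : ∀ i < nl, (σl i).WF nl'
  tys : ∀ i < nt, (σt i).WF nl' nt'
  reloc : ∀ i, (σt i).Reloc

/-- The arguments `L̄ Ā` fit the parameters `l̄ ᾱ` of the binding `d`. -/
structure ArgsOK (nl nt : ℕ) (d : FunDef) (Ls : List Loc) (As : List Ty) : Prop where
  length_locs : Ls.length = d.nl
  length_tys : As.length = d.nt
  locs : ∀ L ∈ Ls, L.WF nl
  tys : ∀ A ∈ As, A.WF nl nt
  reloc : ∀ A ∈ As, A.Reloc

section IsInst

variable {nl nt nl' nt' : ℕ} {σl : ℕ → Loc} {σt : ℕ → Ty}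

theorem IsInst.liftT (h : IsInst nl nt nl' nt' σl σt) :
    IsInst nl (nt + 1) nl' (nt' + 1) σl (Ty.liftT σt) where
  locs := h.locs
  tys := Ty.liftT_wf h.tys
  reloc := Ty.liftT_reloc h.reloc

theorem IsInst.liftL (h : IsInst nl nt nl' nt' σl σt) :
    IsInst (nl + 1) nt (nl' + 1) nt' (liftL σl) (fun i => (σt i).shiftL) where
  locs := liftL_wf h.locs
  tys i hi := (h.tys i hi).shiftL
  reloc i := (h.reloc i).ren _ _

theorem IsInst.instT {A : Ty} (hA : A.WF nl nt) (hr : A.Reloc) :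
    IsInst nl (nt + 1) nl nt Loc.var (ofList Ty.var [A]) where
  locs _ := id
  tys := Nat.forall_lt_succ_left.mpr ⟨hA, fun _ hi => by rwa [ofList_singleton_succ]⟩
  reloc := ofList_forall (fun _ => trivial) (by simpa using hr)

theorem IsInst.instL {L : Loc} (hL : L.WF nl) :
    IsInst (nl + 1) nt nl nt (ofList Loc.var [L]) Ty.var where
  locs := Nat.forall_lt_succ_left.mpr ⟨hL, fun _ hi => by rwa [ofList_singleton_succ]⟩
  tys _ := id
  reloc _ := trivial

variable {d : FunDef} {Ls : List Loc} {As : List Ty}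

theorem ArgsOK.isInst (h : ArgsOK nl nt d Ls As) :
    IsInst d.nl d.nt nl nt (ofList Loc.var Ls) (ofList Ty.var As) where
  locs := h.length_locs ▸ ofList_forall_lt h.locs
  tys := h.length_tys ▸ ofList_forall_lt h.tys
  reloc := ofList_forall (fun _ => trivial) h.reloc

theorem ArgsOK.mono (h : ArgsOK nl nt d Ls As) (hl : nl ≤ nl') (ht : nt ≤ nt') :
    ArgsOK nl' nt' d Ls As where
  __ := h
  locs L hL := (h.locs L hL).mono hl
  tys A hA := (h.tys A hA).mono hl ht

theorem ArgsOK.map (h : ArgsOK nl nt d Ls As) (hσ : IsInst nl nt nl' nt' σl σt) :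
    ArgsOK nl' nt' d (Ls.map (Loc.subst σl)) (As.map (Ty.subst σl σt)) where
  length_locs := by simpa using h.length_locs
  length_tys := by simpa using h.length_tys
  locs := List.forall_mem_map.mpr fun L hL => (h.locs L hL).subst hσ.locs
  tys := List.forall_mem_map.mpr fun A hA => (h.tys A hA).subst hσ.locs hσ.tys
  reloc := List.forall_mem_map.mpr fun A hA => (h.reloc A hA).subst hσ.reloc

theorem ArgsOK.subst_subst (h : ArgsOK nl nt d Ls As) {A : Ty} (hA : A.WF d.nl d.nt)
    (σl : ℕ → Loc) (σt : ℕ → Ty) :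
    (A.subst (ofList Loc.var Ls) (ofList Ty.var As)).subst σl σt
      = A.subst (ofList Loc.var (Ls.map (Loc.subst σl)))
          (ofList Ty.var (As.map (Ty.subst σl σt))) :=
  Ty.subst_ofList (by rwa [h.length_locs, h.length_tys]) σl σt

end IsInst

/-- `D` binds `F` to `d`, with a code and a part of `D` that match the type of `d`. -/
inductive Declared (D : Decomp) (F : FName) (d : FunDef) : Prop where
  | lam {A L B x M} :
      D.at L F = some d → d.ty = .fn A L B → d.code = .lam x M → Declared D F d
  | llam {A V} : D.common F = some d → d.ty = .allL A → d.code = .llam V → Declared D F d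

/-- Every binding of every part of the decomposition is well-typed. -/
def Decomp.OK (D : Decomp) : Prop := ∀ L F d, D.at L F = some d → BindingOK D F d

theorem Decomp.exists_at_iff {D : Decomp} {F : FName} {d : FunDef} :
    (∃ L, D.at L F = some d) ↔
      D.client F = some d ∨ D.server F = some d ∨ D.common F = some d := by
  constructor
  · rintro ⟨(_ | _) | _, h⟩
    exacts [.inl h, .inr (.inl h), .inr (.inr h)]
  · rintro (h | h | h)
    exacts [⟨.const .c, h⟩, ⟨.const .s, h⟩, ⟨.var 0, h⟩]

theorem Program.exists_at_iff {P : Program} {F : FName} {d : FunDef} :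
    (∃ a, P.at a F = some d) ↔ P.client F = some d ∨ P.server F = some d := by
  constructor
  · rintro ⟨_ | _, h⟩
    exacts [.inl h, .inr h]
  · rintro (h | h)
    exacts [⟨.c, h⟩, ⟨.s, h⟩]

theorem Program.WF.decomp_ok {P : Program} {D : Decomp} (hP : P.WF D) : D.OK :=
  fun L F d h => hP.ok F d ((hP.union F d).2 (Decomp.exists_at_iff.mp ⟨L, h⟩))

theorem Program.WF.lookup_eq {P : Program} {D : Decomp} (hP : P.WF D) {a : Side} {L : Loc}
    {F : FName} {d d' : FunDef} (h : P.at a F = some d) (h' : D.at L F = some d') : d = d' := by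
  have hd := (hP.union F d).1 (Program.exists_at_iff.mp ⟨a, h⟩)
  have hd' := Decomp.exists_at_iff.mp ⟨L, h'⟩
  have := hP.disj_client_server F
  have := hP.disj_client_common F
  have := hP.disj_server_common F
  rcases hd with hd | hd | hd <;> rcases hd' with hd' | hd' | hd' <;> simp_all

section FunTyping

variable {D : Decomp} {F : FName} {d : FunDef} {nl nt nl' nt' : ℕ} {Ls : List Loc}
  {As Bs : List Ty} {A : Ty}

theorem BindingOK.ty_wf (h : BindingOK D F d) : d.ty.WF d.nl d.nt := by
  cases h <;> assumption

theorem BindingOK.Bs_wf (h : BindingOK D F d) : ∀ B ∈ d.Bs, B.WF d.nl d.nt := by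
  cases h <;> assumption

theorem Declared.bindingOK (hD : D.OK) (h : Declared D F d) : BindingOK D F d := by
  cases h with
  | lam h => exact hD _ F d h
  | llam h => exact hD (.var 0) F d h

theorem funTyping_iff :
    FunTyping D nl nt F Ls As Bs A ↔
      ∃ d, Declared D F d ∧ ArgsOK nl nt d Ls As ∧ (∀ B ∈ d.Bs, B.Reloc) ∧
        Bs = d.Bs.map (Ty.subst (ofList Loc.var Ls) (ofList Ty.var As)) ∧
        A = d.ty.subst (ofList Loc.var Ls) (ofList Ty.var As) := by
  constructor
  · intro h
    cases h with
    | abs hF hty hcode hLs hAs hL hA hr hB =>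
      exact ⟨_, .lam hF hty hcode, ⟨hLs, hAs, hL, hA, hr⟩, hB, rfl, rfl⟩
    | labs hF hty hcode hLs hAs hL hA hr hB =>
      exact ⟨_, .llam hF hty hcode, ⟨hLs, hAs, hL, hA, hr⟩, hB, rfl, rfl⟩
  · rintro ⟨d, hF, ⟨hLs, hAs, hL, hA, hr⟩, hB, rfl, rfl⟩
    cases hF with
    | lam hF hty hcode => exact .abs hF hty hcode hLs hAs hL hA hr hB
    | llam hF hty hcode => exact .labs hF hty hcode hLs hAs hL hA hr hB

theorem FunTyping.reloc (h : FunTyping D nl nt F Ls As Bs A) : ∀ B ∈ Bs, B.Reloc := by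
  obtain ⟨d, -, hargs, hB, rfl, -⟩ := funTyping_iff.mp h
  exact List.forall_mem_map.mpr fun B hmem => (hB B hmem).subst hargs.isInst.reloc

theorem FunTyping.wf (hD : D.OK) (h : FunTyping D nl nt F Ls As Bs A) : A.WF nl nt := by
  obtain ⟨d, hF, hargs, -, -, rfl⟩ := funTyping_iff.mp h
  exact (hF.bindingOK hD).ty_wf.subst hargs.isInst.locs hargs.isInst.tys

theorem FunTyping.mono (h : FunTyping D nl nt F Ls As Bs A) (hl : nl ≤ nl') (ht : nt ≤ nt') :
    FunTyping D nl' nt' F Ls As Bs A := by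
  obtain ⟨d, hF, hargs, hd⟩ := funTyping_iff.mp h
  exact funTyping_iff.mpr ⟨d, hF, hargs.mono hl ht, hd⟩

theorem FunTyping.subst (hD : D.OK) {σl : ℕ → Loc} {σt : ℕ → Ty}
    (h : FunTyping D nl nt F Ls As Bs A) (hσ : IsInst nl nt nl' nt' σl σt) :
    FunTyping D nl' nt' F (Ls.map (Loc.subst σl)) (As.map (Ty.subst σl σt))
      (Bs.map (Ty.subst σl σt)) (A.subst σl σt) := by
  obtain ⟨d, hF, hargs, hB, rfl, rfl⟩ := funTyping_iff.mp h
  refine funTyping_iff.mpr ⟨d, hF, hargs.map hσ, hB, ?_,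
    hargs.subst_subst (hF.bindingOK hD).ty_wf σl σt⟩
  rw [List.map_map]
  exact List.map_congr_left fun B hmem =>
    hargs.subst_subst ((hF.bindingOK hD).Bs_wf B hmem) σl σt

end FunTyping

/-! ### Structural properties of typing -/

section Typing

variable {D : Decomp} {nl nt nl' nt' : ℕ} {Γ Γ' : Ctx} {L : Loc} {M : Tm} {V W : Val}
  {x : Name} {A B : Ty}

theorem Typing.relocate (h : Typing D nl nt Γ L (.val V) A) (hA : A.Reloc) (L' : Loc) :
    Typing D nl nt Γ L' (.val V) A := by
  generalize hM : Tm.val V = M at h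
  induction h generalizing V with
  | var h => exact .var h
  | clo hF hlen _ ih =>
    exact .clo hF hlen fun p hp => ih p hp (hF.reloc _ (List.of_mem_zip hp).2) rfl
  | pair _ _ ih₁ ih₂ => exact .pair (ih₁ hA.1 rfl) (ih₂ hA.2 rfl)
  | tabs h => exact .tabs h
  | letin | proj1 | proj2 | tapp | lapp | app => nomatch hM
  | unit | bind | gen | req | call => exact hA.elim

theorem Typing.unit_inv (h : Typing D nl nt Γ L (.val (.unit V)) A) :
    ∃ B, A = .T B ∧ Typing D nl nt Γ L (.val V) B ∧ B.Reloc := by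
  cases h with
  | unit h hr => exact ⟨_, rfl, h, hr⟩

theorem Typing.tabs_of_loc {L₀ : Loc}
    (h : Typing D nl (nt + 1) (Γ.mapTy Ty.shiftT) L₀ (.val (.unit V)) A) :
    Typing D nl nt Γ L (.val (.tabs V)) (.allT A) := by
  obtain ⟨B, rfl, hV, hr⟩ := h.unit_inv
  exact .tabs fun L₁ _ => .unit (hV.relocate hr L₁) hr

theorem Typing.weaken (h : Typing D nl nt Γ L M A) (hl : nl ≤ nl') (ht : nt ≤ nt')
    (hΓ : Γ.Sub Γ') : Typing D nl' nt' Γ' L M A := by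
  induction h generalizing nl' nt' Γ' with
  | var h => exact .var (hΓ _ _ h)
  | letin _ _ ih₁ ih₂ => exact .letin (ih₁ hl ht hΓ) (ih₂ hl ht (hΓ.cons _ _))
  | clo hF hlen _ ih => exact .clo (hF.mono hl ht) hlen fun p hp => ih p hp hl ht hΓ
  | proj1 _ ih => exact .proj1 (ih hl ht hΓ)
  | proj2 _ ih => exact .proj2 (ih hl ht hΓ)
  | pair _ _ ih₁ ih₂ => exact .pair (ih₁ hl ht hΓ) (ih₂ hl ht hΓ)
  | tabs _ ih =>
    exact .tabs_of_loc (ih (.const .c) trivial hl (Nat.succ_le_succ ht) (hΓ.mapTy _))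
  | tapp _ hB hr ih => exact .tapp (ih hl ht hΓ) (hB.mono hl ht) hr
  | lapp _ hL ih => exact .lapp (ih hl ht hΓ) (hL.mono hl)
  | unit _ hr ih => exact .unit (ih hl ht hΓ) hr
  | bind _ _ ih₁ ih₂ => exact .bind (ih₁ hl ht hΓ) (ih₂ hl ht (hΓ.cons _ _))
  | app _ _ ih₁ ih₂ => exact .app (ih₁ hl ht hΓ) (ih₂ hl ht hΓ)
  | gen _ _ hr hL ih₁ ih₂ => exact .gen (ih₁ hl ht hΓ) (ih₂ hl ht hΓ) hr (hL.mono hl)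
  | req _ _ hr ih₁ ih₂ => exact .req (ih₁ hl ht hΓ) (ih₂ hl ht hΓ) hr
  | call _ _ hr ih₁ ih₂ => exact .call (ih₁ hl ht hΓ) (ih₂ hl ht hΓ) hr

theorem Typing.wf (hD : D.OK) (h : Typing D nl nt Γ L M A)
    (hΓ : ∀ x A, Γ.lookup x = some A → A.WF nl nt) : A.WF nl nt := by
  induction h with
  | var h => exact hΓ _ _ h
  | letin _ _ ih₁ ih₂ => exact ih₂ (Ctx.forall_lookup_cons hΓ (ih₁ hΓ))
  | clo hF => exact (hF.wf hD :)
  | proj1 _ ih => exact (ih hΓ).1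
  | proj2 _ ih => exact (ih hΓ).2
  | pair _ _ ih₁ ih₂ => exact ⟨ih₁ hΓ, ih₂ hΓ⟩
  | @tabs _ Γ _ _ _ _ ih =>
    refine ih (.const .c) trivial fun x A h => ?_
    obtain ⟨B, hB, rfl⟩ := Option.map_eq_some_iff.mp (Γ.lookup_mapTy Ty.shiftT x ▸ h)
    exact (hΓ x B hB).shiftT
  | @tapp nt _ _ _ _ _ _ hB hr ih =>
    have hσ := IsInst.instT hB hr
    exact Ty.WF.subst (nt := nt + 1) (ih hΓ) hσ.locs hσ.tys
  | @lapp nt _ _ _ _ _ _ hL ih =>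
    have hσ := IsInst.instL (nt := nt) hL
    exact Ty.WF.subst (nl := nl + 1) (ih hΓ) hσ.locs hσ.tys
  | unit _ _ ih => exact ih hΓ
  | bind _ _ ih₁ ih₂ => exact ih₂ (Ctx.forall_lookup_cons hΓ (ih₁ hΓ))
  | app _ _ ih | gen _ _ _ _ ih | req _ _ _ ih | call _ _ _ ih => exact (ih hΓ).2.2

theorem Typing.wf_of_closed (hD : D.OK) (h : Typing D nl nt [] L M A) : A.WF nl nt :=
  h.wf hD fun _ _ h => nomatch h

theorem Typing.subst_eq_self (h : Typing D nl nt Γ L M A) (hx : Γ.lookup x = none) (U : Val) :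
    M.subst x U = M := by
  have hcons {Γ : Ctx} {y : Name} {B : Ty} (h : Γ.lookup x = none) (hxy : x ≠ y) :
      List.lookup x ((y, B) :: Γ) = none := by rwa [Ctx.lookup_cons, if_neg hxy]
  induction h with
  | @var _ _ _ y _ h =>
    have hxy : x ≠ y := by
      rintro rfl
      exact nomatch hx.symm.trans h
    simp only [Tm.subst, Val.subst, if_neg hxy]
  | @letin _ _ _ y _ _ _ _ _ _ ih₁ ih₂ | @bind _ _ _ y _ _ _ _ _ _ ih₁ ih₂ =>
    by_cases hxy : x = y
    · simp only [Tm.subst, Val.subst, ih₁ hx, if_pos hxy]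
    · simp only [Tm.subst, Val.subst, ih₁ hx, if_neg hxy, ih₂ (hcons hx hxy)]
  | clo _ hlen _ ih =>
    simp only [Tm.subst, Val.subst, Val.substList_eq_map, Tm.val.injEq, Val.clo.injEq, and_true]
    refine (List.map_congr_left fun W hW => ?_).trans (List.map_id _)
    obtain ⟨B, hB⟩ := exists_mem_zip_of_mem_left hlen hW
    exact Tm.val.inj (ih _ hB hx)
  | tabs _ ih =>
    simpa [Tm.subst, Val.subst] using
      ih (.const .c) trivial ((Ctx.lookup_mapTy ..).trans (by rw [hx]; rfl))
  | proj1 _ ih | proj2 _ ih | tapp _ _ _ ih | lapp _ _ ih | unit _ _ ih =>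
    simpa [Tm.subst, Val.subst] using ih hx
  | pair _ _ ih₁ ih₂ | app _ _ ih₁ ih₂ | gen _ _ _ _ ih₁ ih₂ | req _ _ _ ih₁ ih₂
  | call _ _ _ ih₁ ih₂ =>
    simpa [Tm.subst, Val.subst] using And.intro (ih₁ hx) (ih₂ hx)

theorem Typing.inst_eq_self (h : Typing D nl nt Γ L M A) {σl : ℕ → Loc} {σt : ℕ → Ty}
    (hl : ∀ i < nl, σl i = .var i) (ht : ∀ i < nt, σt i = .var i) : M.inst σl σt = M := by
  have hloc {L : Loc} (hL : L.WF nl) : L.subst σl = L := by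
    rw [Loc.subst_congr hL hl, Loc.subst_var]
  induction h generalizing σt with
  | var => rfl
  | clo hF hlen _ ih =>
    obtain ⟨_, _, hargs, _⟩ := funTyping_iff.mp hF
    simp only [Tm.inst, Val.inst, Val.instList_eq_map]
    congr 2
    · refine (List.map_congr_left fun W hW => ?_).trans (List.map_id _)
      obtain ⟨B, hB⟩ := exists_mem_zip_of_mem_left hlen hW
      exact Tm.val.inj (ih _ hB ht)
    · exact (List.map_congr_left fun L hL => hloc (hargs.locs L hL)).trans (List.map_id _)
    · exact (List.map_congr_left fun A hA => Ty.subst_eq_self (hargs.tys A hA) hl ht).trans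
        (List.map_id _)
  | tabs _ ih =>
    simpa [Tm.inst, Val.inst] using ih (.const .c) trivial (Ty.liftT_eq_var ht)
  | tapp _ hB _ ih => simpa [Tm.inst, Ty.subst_eq_self hB hl ht] using ih ht
  | lapp _ hL ih => simpa [Tm.inst, hloc hL] using ih ht
  | proj1 _ ih | proj2 _ ih | unit _ _ ih => simpa [Tm.inst, Val.inst] using ih ht
  | gen _ _ _ hL ih₁ ih₂ =>
    simpa [Tm.inst, Val.inst, hloc hL] using And.intro (ih₁ ht) (ih₂ ht)
  | letin _ _ ih₁ ih₂ | bind _ _ ih₁ ih₂ | pair _ _ ih₁ ih₂ | app _ _ ih₁ ih₂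
  | req _ _ _ ih₁ ih₂ | call _ _ _ ih₁ ih₂ =>
    simpa [Tm.inst, Val.inst] using And.intro (ih₁ ht) (ih₂ ht)

theorem Typing.subst_under {Γ₀ : Ctx} {y : Name} {C : Ty}
    (h : Typing D nl nt ((y, C) :: Γ₀) L M A) (hΓ : Γ₀.Sub ((x, B) :: Γ))
    (hsubst : Ctx.Sub ((y, C) :: Γ₀) ((x, B) :: (y, C) :: Γ) →
      Typing D nl nt ((y, C) :: Γ) L (M.subst x W) A) :
    Typing D nl nt ((y, C) :: Γ) L (if x = y then M else M.subst x W) A := by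
  split_ifs with hxy
  · subst hxy
    exact h.weaken le_rfl le_rfl ((hΓ.cons _ _).trans (.shadow _ _ _ _))
  · exact hsubst ((hΓ.cons _ _).trans (.swap _ (Ne.symm hxy) _ _))

theorem Typing.subst {Γ₀ : Ctx} (hD : D.OK) (h : Typing D nl nt Γ₀ L M A)
    (hΓ : Γ₀.Sub ((x, B) :: Γ)) (hL : L.WF nl) (hW : Typing D 0 0 [] L (.val W) B) :
    Typing D nl nt Γ L (M.subst x W) A := by
  have hB : B.shiftT = B := Ty.ren_eq_self (hW.wf_of_closed hD) _ _
  induction h generalizing Γ with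
  | @var nt _ L y A h =>
    have hy := hΓ y A h
    rw [Ctx.lookup_cons] at hy
    simp only [Tm.subst, Val.subst]
    split_ifs at hy ⊢ with hyx hxy hxy
    · exact Option.some.inj hy ▸ hW.weaken (Nat.zero_le nl) (Nat.zero_le nt) (.nil Γ)
    · exact (hxy hyx.symm).elim
    · exact (hyx hxy.symm).elim
    · exact .var hy
  | letin _ hN ih₁ ih₂ =>
    exact .letin (ih₁ hΓ hL hW) (hN.subst_under hΓ fun h => ih₂ h hL hW)
  | bind _ hN ih₁ ih₂ =>
    exact .bind (ih₁ hΓ hL hW) (hN.subst_under hΓ fun h => ih₂ h hL hW)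
  | clo hF hlen _ ih =>
    simp only [Tm.subst, Val.subst, Val.substList_eq_map]
    refine .clo hF (by rwa [List.length_map]) ?_
    exact forall_mem_zip_map_left (p := fun V B => Typing D _ _ Γ _ (.val V) B)
      fun p hp => ih p hp hΓ hL hW
  | proj1 _ ih => exact .proj1 (ih hΓ hL hW)
  | proj2 _ ih => exact .proj2 (ih hΓ hL hW)
  | pair _ _ ih₁ ih₂ => exact .pair (ih₁ hΓ hL hW) (ih₂ hΓ hL hW)
  | @tabs _ _ L _ _ _ ih =>
    refine .tabs_of_loc (ih L hL ?_ hL hW)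
    have hΓ' := hΓ.mapTy Ty.shiftT
    rwa [Ctx.mapTy, Ctx.mapTy, List.map_cons, hB] at hΓ'
  | tapp _ hC hr ih => exact .tapp (ih hΓ hL hW) hC hr
  | lapp _ hL' ih => exact .lapp (ih hΓ hL hW) hL'
  | unit _ hr ih => exact .unit (ih hΓ hL hW) hr
  | app _ _ ih₁ ih₂ => exact .app (ih₁ hΓ hL hW) (ih₂ hΓ hL hW)
  | gen _ _ hr hL' ih₁ ih₂ => exact .gen (ih₁ hΓ hL hW) (ih₂ hΓ hL hW) hr hL'
  | req _ _ hr ih₁ ih₂ => exact .req (ih₁ hΓ hL hW) (ih₂ hΓ hL hW) hr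
  | call _ _ hr ih₁ ih₂ => exact .call (ih₁ hΓ hL hW) (ih₂ hΓ hL hW) hr

theorem Typing.subst_head (hD : D.OK) (h : Typing D nl nt ((x, B) :: Γ) L M A) (hL : L.WF nl)
    (hW : Typing D 0 0 [] L (.val W) B) : Typing D nl nt Γ L (M.subst x W) A :=
  h.subst hD (.refl _) hL hW

theorem Typing.substs (hD : D.OK) {zs : List Name} {Ws : List Val} {Bs : List Ty}
    (h : Typing D nl nt (zs.zip Bs ++ Γ) L M A) (hL : L.WF nl)
    (hzs : zs.length = Bs.length) (hWs : Ws.length = Bs.length)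
    (hW : ∀ p ∈ Ws.zip Bs, Typing D 0 0 [] L (.val p.1) p.2) :
    Typing D nl nt Γ L (M.substs zs Ws) A := by
  induction zs generalizing M Ws Bs with
  | nil =>
    obtain rfl := List.length_eq_zero_iff.mp hzs.symm
    exact h
  | cons z zs ih =>
    obtain ⟨B, Bs, rfl⟩ := List.exists_cons_of_length_eq_add_one hzs.symm
    obtain ⟨W, Ws, rfl⟩ := List.exists_cons_of_length_eq_add_one hWs
    obtain ⟨hWB, hWs'⟩ := List.forall_mem_cons.mp hW
    exact ih (h.subst_head hD hL hWB) (Nat.succ.inj hzs) (Nat.succ.inj hWs) hWs'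

theorem Val.substs_val (V : Val) (zs : List Name) (Ws : List Val) :
    (Tm.val V).substs zs Ws = .val (V.substs zs Ws) := by
  simp only [Tm.substs, Val.substs]
  induction zs.zip Ws generalizing V with
  | nil => rfl
  | cons p ps ih => simp only [List.foldl_cons, Tm.subst, ih]

theorem Typing.inst (hD : D.OK) (h : Typing D nl nt Γ L M A) {σl : ℕ → Loc} {σt : ℕ → Ty}
    (hσ : IsInst nl nt nl' nt' σl σt) :
    Typing D nl' nt' (Γ.mapTy (Ty.subst σl σt)) (L.subst σl) (M.inst σl σt) (A.subst σl σt) := by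
  induction h generalizing nl' nt' σl σt with
  | var h => exact .var (by rw [Ctx.lookup_mapTy, h, Option.map_some])
  | letin _ _ ih₁ ih₂ => exact .letin (ih₁ hσ) (ih₂ hσ)
  | clo hF hlen _ ih =>
    simp only [Tm.inst, Val.inst, Val.instList_eq_map]
    refine .clo (hF.subst hD hσ) (by rwa [List.length_map, List.length_map]) fun p hp => ?_
    rw [List.zip_map, List.mem_map] at hp
    obtain ⟨q, hq, rfl⟩ := hp
    exact ih q hq hσ
  | proj1 _ ih => exact .proj1 (ih hσ)
  | proj2 _ ih => exact .proj2 (ih hσ)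
  | pair _ _ ih₁ ih₂ => exact .pair (ih₁ hσ) (ih₂ hσ)
  | tabs _ ih =>
    refine .tabs_of_loc (L₀ := .const .c) ?_
    have hbody := ih (.const .c) trivial hσ.liftT
    simp only [Ctx.mapTy, List.map_map, Function.comp_def, Ty.shiftT_subst] at hbody ⊢
    exact hbody
  | tapp _ hB hr ih =>
    rw [Ty.instT_subst]
    exact .tapp (ih hσ) (hB.subst hσ.locs hσ.tys) (hr.subst hσ.reloc)
  | lapp _ hL ih =>
    rw [Ty.instL_subst]
    exact .lapp (ih hσ) (hL.subst hσ.locs)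
  | unit _ hr ih => exact .unit (ih hσ) (hr.subst hσ.reloc)
  | bind _ _ ih₁ ih₂ => exact .bind (ih₁ hσ) (ih₂ hσ)
  | app _ _ ih₁ ih₂ => exact .app (ih₁ hσ) (ih₂ hσ)
  | gen _ _ hr hL ih₁ ih₂ =>
    exact .gen (ih₁ hσ) (ih₂ hσ) (hr.subst hσ.reloc) (hL.subst hσ.locs)
  | req _ _ hr ih₁ ih₂ => exact .req (ih₁ hσ) (ih₂ hσ) (hr.subst hσ.reloc)
  | call _ _ hr ih₁ ih₂ => exact .call (ih₁ hσ) (ih₂ hσ) (hr.subst hσ.reloc)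

end Typing

/-! ### Subject reduction -/

section SubjectReduction

variable {P : Program} {D : Decomp} {nl nt : ℕ} {F : FName} {d : FunDef} {Ls : List Loc}
  {As : List Ty} {A B : Ty} {L : Loc} {a : Side} {x : Name} {M M' : Tm} {V : Val}
  {Ws : List Val} {zs : List Name}

theorem BindingOK.length_zs (h : BindingOK D F d) : d.zs.length = d.Bs.length := by
  cases h <;> assumption

theorem BindingOK.lam_body (hD : D.OK) (hd : BindingOK D F d) (hargs : ArgsOK nl nt d Ls As)
    (hty : d.ty.subst (ofList Loc.var Ls) (ofList Ty.var As) = .fn A L B)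
    (hcode : d.code.inst Ls As = .lam x M) :
    Typing D nl nt (d.zs.zip (d.Bs.map (Ty.subst (ofList Loc.var Ls) (ofList Ty.var As)))
      ++ [(x, A)]) L M B := by
  cases hd with
  | labs hty' => exact nomatch hty.symm.trans (congrArg _ hty')
  | abs hty' hcode' _ _ hnodup _ _ hM =>
    rw [hty'] at hty
    rw [hcode'] at hcode
    cases hty
    cases hcode
    have hM' := hM.inst hD hargs.isInst
    rw [Ctx.mapTy, List.map_cons, ← Ctx.mapTy, Ctx.mapTy_zip] at hM'
    exact hM'.weaken le_rfl le_rfl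
      (.cons_append (lookup_zip_eq_none _ (List.nodup_cons.mp hnodup).1) _)

theorem BindingOK.llam_body (hD : D.OK) (hd : BindingOK D F d) (hargs : ArgsOK nl nt d Ls As)
    (hty : d.ty.subst (ofList Loc.var Ls) (ofList Ty.var As) = .allL A)
    (hcode : d.code.inst Ls As = .llam V) (a : Side) :
    Typing D (nl + 1) nt
      (d.zs.zip ((d.Bs.map (Ty.subst (ofList Loc.var Ls) (ofList Ty.var As))).map Ty.shiftL))
      (.const a) (.val V) A := by
  cases hd with
  | abs hty' => exact nomatch hty.symm.trans (congrArg _ hty')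
  | labs hty' hcode' _ _ _ _ _ hV =>
    rw [hty'] at hty
    rw [hcode'] at hcode
    cases hty
    cases hcode
    have hV' := (hV (.const a) trivial).inst hD hargs.isInst.liftL
    simp only [Ctx.mapTy_zip, List.map_map, Function.comp_def, Ty.shiftL_subst] at hV' ⊢
    exact hV'

theorem Typing.clo_lookup (hP : P.WF D) {Γ : Ctx} {o : OpenCode}
    (h : Typing D nl nt Γ L (.val (.clo Ws F Ls As)) (.clo A))
    (hΦ : Lookup (P.at a) F Ls As zs o) :
    ∃ d, P.at a F = some d ∧ BindingOK D F d ∧ ArgsOK nl nt d Ls As ∧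
      A = d.ty.subst (ofList Loc.var Ls) (ofList Ty.var As) ∧
      zs = d.zs ∧ o = d.code.inst Ls As ∧
      Ws.length = (d.Bs.map (Ty.subst (ofList Loc.var Ls) (ofList Ty.var As))).length ∧
      ∀ p ∈ Ws.zip (d.Bs.map (Ty.subst (ofList Loc.var Ls) (ofList Ty.var As))),
        Typing D nl nt Γ L (.val p.1) p.2 := by
  obtain ⟨d', hd', -, -, rfl, rfl⟩ := hΦ
  cases h with
  | clo hF hlen hW =>
    obtain ⟨d, hd, hargs, -, rfl, rfl⟩ := funTyping_iff.mp hF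
    obtain rfl : d' = d := by
      cases hd with
      | lam hd => exact hP.lookup_eq hd' hd
      | llam hd => exact hP.lookup_eq (L := .var 0) hd' hd
    exact ⟨d', hd', hd.bindingOK hP.decomp_ok, hargs, rfl, rfl, rfl, hlen, hW⟩

theorem Typing.lam_body (hP : P.WF D) {W : Val}
    (hV : Typing D 0 0 [] L (.val (.clo Ws F Ls As)) (.clo (.fn A L B)))
    (hW : Typing D 0 0 [] L (.val W) A) (hL : L.WF 0)
    (hΦ : Lookup (P.at a) F Ls As zs (.lam x M)) :
    Typing D 0 0 [] L ((M.substs zs Ws).subst x W) B := by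
  have hD := hP.decomp_ok
  obtain ⟨d, -, hd, hargs, hty, rfl, hcode, hlen, hWs⟩ := hV.clo_lookup hP hΦ
  have hM := hd.lam_body hD hargs hty.symm hcode.symm
  exact (hM.substs hD hL (by rw [List.length_map, hd.length_zs]) hlen hWs).subst_head hD hL hW

theorem Typing.llam_body (hP : P.WF D)
    (hV : Typing D 0 0 [] (.const a) (.val (.clo Ws F Ls As)) (.clo (.allL A)))
    (hΦ : Lookup (P.at a) F Ls As zs (.llam V)) :
    Typing D 1 0 [] (.const a) (.val (V.substs zs Ws)) A := by
  have hD := hP.decomp_ok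
  obtain ⟨d, -, hd, hargs, hty, rfl, hcode, hlen, hWs⟩ := hV.clo_lookup hP hΦ
  have hbody := hd.llam_body hD hargs hty.symm hcode.symm a
  have hclosed : ∀ B ∈ d.Bs.map (Ty.subst (ofList Loc.var Ls) (ofList Ty.var As)),
      B.shiftL = B := by
    refine List.forall_mem_map.mpr fun B hB => Ty.ren_eq_self ?_ _ _
    exact (hd.Bs_wf B hB).subst hargs.isInst.locs hargs.isInst.tys
  rw [List.map_congr_left hclosed, List.map_id', ← List.append_nil (d.zs.zip _)] at hbody
  rw [← Val.substs_val]
  exact hbody.substs hD trivial (by rw [List.length_map, hd.length_zs]) hlen hWs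

theorem LocalStep.typing (hP : P.WF D) (hs : LocalStep (P.at a) M M')
    (h : Typing D 0 0 [] (.const a) M A) : Typing D 0 0 [] (.const a) M' A := by
  have hD := hP.decomp_ok
  cases hs with
  | letin =>
    cases h with
    | letin hV hM => exact hM.subst_head hD trivial hV
  | bind =>
    cases h with
    | bind hV hM =>
      cases hV with
      | unit hV => exact hM.subst_head hD trivial hV
  | proj1 =>
    cases h with
    | proj1 h => cases h with | pair hV _ => exact hV
  | proj2 =>
    cases h with
    | proj2 h => cases h with | pair _ hW => exact hW
  | tapp =>
    cases h with
    | tapp h hB hr =>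
      cases h with
      | tabs h => exact (h (.const a) trivial).inst hD (.instT hB hr)
  | app hΦ =>
    cases h with
    | app hV hW => exact hV.lam_body hP hW trivial hΦ
  | lapp hΦ =>
    cases h with
    | lapp h hL => exact (h.llam_body hP hΦ).inst hD (.instL hL)

end SubjectReduction

/-! ### Big-step semantics -/

/-- Terms that eliminate a value: everything but values and `let`. -/
def Tm.IsElim : Tm → Prop
  | .val _ | .letin _ _ _ => False
  | _ => True

/-- `Ev Φ M V`: the term `M` evaluates to the value `V`, where a monadic value is not run but
counts as a result, whether or not it could be reduced further. -/
inductive Ev (Φ : FunMap) : Tm → Val → Prop where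
  | val {V} : Ev Φ (.val V) V
  | letin {x M N V W} : Ev Φ M V → Ev Φ (N.subst x V) W → Ev Φ (.letin x M N) W
  | step {M M' V} : M.IsElim → LocalStep Φ M M' → Ev Φ M' V → Ev Φ M V

/-- `RunVal P a V U`: running the monadic value `V` at `a` returns `U`, possibly after
communication with the other side. -/
inductive RunVal (P : Program) : Side → Val → Val → Prop where
  | unit {a U} : RunVal P a (.unit U) U
  | bind {a x M N V U V' U'} :
      Ev (P.at a) M V → RunVal P a V U → Ev (P.at a) (N.subst x U) V' → RunVal P a V' U' →
      RunVal P a (.bind x M N) U'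
  | req {V W V' U} :
      Ev (P.at .s) (.app V W) V' → RunVal P .s V' U → RunVal P .c (.req V W) U
  | call {V W V' U} :
      Ev (P.at .c) (.app V W) V' → RunVal P .c V' U → RunVal P .s (.call V W) U
  | gen {a V W V' U} :
      Ev (P.at a) (.app V W) V' → RunVal P a V' U → RunVal P a (.gen (.const a) V W) U
  | genReq {V W U} : RunVal P .c (.req V W) U → RunVal P .c (.gen (.const .s) V W) U
  | genCall {V W U} : RunVal P .s (.call V W) U → RunVal P .s (.gen (.const .c) V W) U

/-- `Run P a M U`: the term `M` evaluates at `a` to a monadic value, and running it returns `U`. -/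
def Run (P : Program) (a : Side) (M : Tm) (U : Val) : Prop :=
  ∃ V, Ev (P.at a) M V ∧ RunVal P a V U

section BigStep

variable {P : Program} {D : Decomp} {a b : Side} {M : Tm} {V W U : Val} {A B : Ty}

theorem Ev.val_inv {Φ : FunMap} (h : Ev Φ (.val V) W) : W = V := by
  cases h with
  | val => rfl
  | step hM => exact hM.elim

theorem Ev.typing (hP : P.WF D) (he : Ev (P.at a) M V) (h : Typing D 0 0 [] (.const a) M A) :
    Typing D 0 0 [] (.const a) (.val V) A := by
  induction he generalizing A with
  | val => exact h
  | letin _ _ ih₁ ih₂ =>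
    cases h with
    | letin hM hN => exact ih₂ (hN.subst_head hP.decomp_ok trivial (ih₁ hM))
  | step _ hs _ ih => exact ih (hs.typing hP h)

theorem Typing.app_of_remote
    (hV : Typing D 0 0 [] (.const a) (.val V) (.clo (.fn A (.const b) B)))
    (hW : Typing D 0 0 [] (.const a) (.val W) A) (hA : A.Reloc) :
    Typing D 0 0 [] (.const b) (.app V W) B :=
  .app (hV.relocate trivial _) (hW.relocate hA _)

theorem RunVal.typing (hP : P.WF D) (hr : RunVal P a V U)
    (h : Typing D 0 0 [] (.const a) (.val V) (.T A)) :
    Typing D 0 0 [] (.const a) (.val U) A ∧ A.Reloc := by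
  induction hr generalizing A with
  | unit => cases h with | unit h hr => exact ⟨h, hr⟩
  | bind heM _ heN _ ih₁ ih₂ =>
    cases h with
    | bind hM hN =>
      have hU := (ih₁ (heM.typing hP hM)).1
      exact ih₂ (heN.typing hP (hN.subst_head hP.decomp_ok trivial hU))
  | req he _ ih =>
    cases h with
    | req hV hW hA =>
      obtain ⟨hU, hB⟩ := ih (he.typing hP (hV.app_of_remote hW hA))
      exact ⟨hU.relocate hB _, hB⟩
  | call he _ ih =>
    cases h with
    | call hV hW hA =>
      obtain ⟨hU, hB⟩ := ih (he.typing hP (hV.app_of_remote hW hA))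
      exact ⟨hU.relocate hB _, hB⟩
  | gen he _ ih => cases h with | gen hV hW hA => exact ih (he.typing hP (.app hV hW))
  | genReq _ ih => cases h with | gen hV hW hA => exact ih (.req hV hW hA)
  | genCall _ ih => cases h with | gen hV hW hA => exact ih (.call hV hW hA)

end BigStep

/-! ### Movable values -/

/-- Values without monadic values outside of function bodies and of the implicit `unit` of type
abstractions: the values of relocatable type. -/
inductive Movable : Val → Prop where
  | var {x} : Movable (.var x)
  | pair {V W} : Movable V → Movable W → Movable (.pair V W)
  | clo {Ws F Ls As} : (∀ W ∈ Ws, Movable W) → Movable (.clo Ws F Ls As)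
  | tabs {V} : Movable V → Movable (.tabs V)

theorem Typing.movable {D : Decomp} {nl nt : ℕ} {Γ : Ctx} {L : Loc} {V : Val} {A : Ty}
    (h : Typing D nl nt Γ L (.val V) A) (hA : A.Reloc) : Movable V := by
  generalize hM : Tm.val V = M at h
  suffices (∀ V, M = .val V → A.Reloc → Movable V) ∧ ∀ V, M = .val (.unit V) → Movable V from
    this.1 V hM.symm hA
  clear hM hA
  induction h with
  | var => exact ⟨by rintro _ ⟨⟩ _; exact .var, nofun⟩
  | clo hF hlen _ ih =>
    refine ⟨?_, nofun⟩
    rintro _ ⟨⟩ _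
    refine .clo fun W hW => ?_
    obtain ⟨B, hB⟩ := exists_mem_zip_of_mem_left hlen hW
    exact (ih _ hB).1 _ rfl (hF.reloc _ (List.of_mem_zip hB).2)
  | pair _ _ ih₁ ih₂ =>
    exact ⟨by rintro _ ⟨⟩ hA; exact .pair (ih₁.1 _ rfl hA.1) (ih₂.1 _ rfl hA.2), nofun⟩
  | tabs _ ih => exact ⟨by rintro _ ⟨⟩ _; exact .tabs ((ih (.const .c) trivial).2 _ rfl), nofun⟩
  | unit _ hA ih => exact ⟨fun _ _ h => h.elim, by rintro _ ⟨⟩; exact ih.1 _ rfl hA⟩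
  | bind | gen | req | call => exact ⟨fun _ _ h => h.elim, nofun⟩
  | letin | proj1 | proj2 | tapp | lapp | app => exact ⟨nofun, nofun⟩

/-! ### Computations forced in advance -/

/-- The values of monadic form. -/
def Val.Monadic : Val → Prop
  | .unit _ | .bind _ _ _ | .req _ _ | .call _ _ | .gen _ _ _ => True
  | _ => False

/-- A value without free variables, expressed through its invariance under substitution. -/
structure Val.Closed (V : Val) : Prop where
  subst_eq : ∀ x U, V.subst x U = V
  inst_eq : ∀ σl σt, V.inst σl σt = V

/-- The closed monadic value `V` returns only what the closed value `R` returns. In the relation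
`Forced`, `V` is a reduct of `R`. -/
structure Forcing (P : Program) (a : Side) (V R : Val) : Prop where
  monadic : V.Monadic
  closed_left : V.Closed
  closed_right : R.Closed
  run : ∀ U, RunVal P a V U → RunVal P a R U

/-- `Forced P a M N`: the term `M` arises from `N` when some closed monadic values are replaced
by values to which they have been reduced in advance. -/
inductive Forced (P : Program) (a : Side) : Tm → Tm → Prop where
  | base {V R} : Forcing P a V R → Forced P a (.val V) (.val R)
  | var {x} : Forced P a (.val (.var x)) (.val (.var x))
  | pair {V W V' W'} : Forced P a (.val V) (.val V') → Forced P a (.val W) (.val W') →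
      Forced P a (.val (.pair V W)) (.val (.pair V' W'))
  | clo {Ws Ws' F Ls As} : Ws.length = Ws'.length →
      (∀ p ∈ Ws.zip Ws', Forced P a (.val p.1) (.val p.2)) →
      Forced P a (.val (.clo Ws F Ls As)) (.val (.clo Ws' F Ls As))
  | tabs {V V'} : Forced P a (.val V) (.val V') → Forced P a (.val (.tabs V)) (.val (.tabs V'))
  | unit {V V'} : Forced P a (.val V) (.val V') → Forced P a (.val (.unit V)) (.val (.unit V'))
  | bind {x M N M' N'} : Forced P a M M' → Forced P a N N' →
      Forced P a (.val (.bind x M N)) (.val (.bind x M' N'))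
  | req {V W V' W'} : Forced P a (.val V) (.val V') → Forced P a (.val W) (.val W') →
      Forced P a (.val (.req V W)) (.val (.req V' W'))
  | call {V W V' W'} : Forced P a (.val V) (.val V') → Forced P a (.val W) (.val W') →
      Forced P a (.val (.call V W)) (.val (.call V' W'))
  | gen {L V W V' W'} : Forced P a (.val V) (.val V') → Forced P a (.val W) (.val W') →
      Forced P a (.val (.gen L V W)) (.val (.gen L V' W'))
  | letin {x M N M' N'} : Forced P a M M' → Forced P a N N' →
      Forced P a (.letin x M N) (.letin x M' N')
  | proj {i V V'} : Forced P a (.val V) (.val V') → Forced P a (.proj i V) (.proj i V')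
  | app {V W V' W'} : Forced P a (.val V) (.val V') → Forced P a (.val W) (.val W') →
      Forced P a (.app V W) (.app V' W')
  | tapp {V V' A} : Forced P a (.val V) (.val V') → Forced P a (.tapp V A) (.tapp V' A)
  | lapp {V V' L} : Forced P a (.val V) (.val V') → Forced P a (.lapp V L) (.lapp V' L)

section Forced

variable {P : Program} {D : Decomp} {a : Side} {L : Loc} {M M' : Tm} {V V' U U' : Val} {A : Ty}

theorem Typing.monadic {nl nt : ℕ} (h : Typing D nl nt [] L (.val V) (.T A)) : V.Monadic := by
  cases h with
  | var h => cases h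
  | _ => trivial

theorem Typing.closed (h : Typing D 0 0 [] L (.val V) A) : V.Closed where
  subst_eq _ U := Tm.val.inj (h.subst_eq_self rfl U)
  inst_eq _ _ := Tm.val.inj (h.inst_eq_self (fun _ hi => nomatch hi) fun _ hi => nomatch hi)

mutual
  theorem Forced.refl_val (P : Program) (a : Side) : ∀ V : Val, Forced P a (.val V) (.val V)
    | .var _ => .var
    | .pair V W => .pair (refl_val P a V) (refl_val P a W)
    | .clo Ws _ _ _ => .clo rfl (refl_list P a Ws)
    | .tabs V => .tabs (refl_val P a V)
    | .unit V => .unit (refl_val P a V)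
    | .bind _ M N => .bind (refl P a M) (refl P a N)
    | .req V W => .req (refl_val P a V) (refl_val P a W)
    | .call V W => .call (refl_val P a V) (refl_val P a W)
    | .gen _ V W => .gen (refl_val P a V) (refl_val P a W)
  theorem Forced.refl_list (P : Program) (a : Side) : ∀ Vs : List Val,
      ∀ p ∈ Vs.zip Vs, Forced P a (.val p.1) (.val p.2)
    | [] => nofun
    | V :: Vs => List.forall_mem_cons.mpr ⟨refl_val P a V, refl_list P a Vs⟩
  theorem Forced.refl (P : Program) (a : Side) : ∀ M : Tm, Forced P a M M
    | .val V => refl_val P a V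
    | .letin _ M N => .letin (refl P a M) (refl P a N)
    | .proj _ V => .proj (refl_val P a V)
    | .app V W => .app (refl_val P a V) (refl_val P a W)
    | .tapp V _ => .tapp (refl_val P a V)
    | .lapp V _ => .lapp (refl_val P a V)
end

theorem Forced.subst (h : Forced P a M M') (hU : Forced P a (.val U) (.val U')) (x : Name) :
    Forced P a (M.subst x U) (M'.subst x U') := by
  induction h with
  | base h =>
    simp only [Tm.subst, h.closed_left.subst_eq, h.closed_right.subst_eq]
    exact .base h
  | var =>
    simp only [Tm.subst, Val.subst]
    split_ifs
    exacts [hU, .var]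
  | clo hlen _ ih =>
    simp only [Tm.subst, Val.subst, Val.substList_eq_map]
    refine .clo (by rwa [List.length_map, List.length_map]) fun p hp => ?_
    rw [List.zip_map, List.mem_map] at hp
    obtain ⟨q, hq, rfl⟩ := hp
    exact ih q hq
  | bind _ hN ih₁ ih₂ => exact .bind ih₁ (by split_ifs; exacts [hN, ih₂])
  | letin _ hN ih₁ ih₂ => exact .letin ih₁ (by split_ifs; exacts [hN, ih₂])
  | pair _ _ ih₁ ih₂ => exact .pair ih₁ ih₂
  | tabs _ ih => exact .tabs ih
  | unit _ ih => exact .unit ih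
  | req _ _ ih₁ ih₂ => exact .req ih₁ ih₂
  | call _ _ ih₁ ih₂ => exact .call ih₁ ih₂
  | gen _ _ ih₁ ih₂ => exact .gen ih₁ ih₂
  | proj _ ih => exact .proj ih
  | app _ _ ih₁ ih₂ => exact .app ih₁ ih₂
  | tapp _ ih => exact .tapp ih
  | lapp _ ih => exact .lapp ih

theorem Forced.substs (h : Forced P a M M') {Ws Ws' : List Val} (hlen : Ws.length = Ws'.length)
    (hW : ∀ p ∈ Ws.zip Ws', Forced P a (.val p.1) (.val p.2)) (zs : List Name) :
    Forced P a (M.substs zs Ws) (M'.substs zs Ws') := by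
  induction zs generalizing M M' Ws Ws' with
  | nil => exact h
  | cons z zs ih =>
    match Ws, Ws', hlen with
    | [], [], _ => exact h
    | W :: Ws, W' :: Ws', hlen =>
      obtain ⟨hWW', hWs⟩ := List.forall_mem_cons.mp hW
      exact ih (h.subst hWW' z) (Nat.succ.inj hlen) hWs

theorem Forced.inst (h : Forced P a M M') (σl : ℕ → Loc) (σt : ℕ → Ty) :
    Forced P a (M.inst σl σt) (M'.inst σl σt) := by
  induction h generalizing σt with
  | base h =>
    simp only [Tm.inst, h.closed_left.inst_eq, h.closed_right.inst_eq]
    exact .base h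
  | var => exact .var
  | clo hlen _ ih =>
    simp only [Tm.inst, Val.inst, Val.instList_eq_map]
    refine .clo (by rwa [List.length_map, List.length_map]) fun p hp => ?_
    rw [List.zip_map, List.mem_map] at hp
    obtain ⟨q, hq, rfl⟩ := hp
    exact ih q hq _
  | pair _ _ ih₁ ih₂ => exact .pair (ih₁ _) (ih₂ _)
  | tabs _ ih => exact .tabs (ih _)
  | unit _ ih => exact .unit (ih _)
  | bind _ _ ih₁ ih₂ => exact .bind (ih₁ _) (ih₂ _)
  | req _ _ ih₁ ih₂ => exact .req (ih₁ _) (ih₂ _)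
  | call _ _ ih₁ ih₂ => exact .call (ih₁ _) (ih₂ _)
  | gen _ _ ih₁ ih₂ => exact .gen (ih₁ _) (ih₂ _)
  | letin _ _ ih₁ ih₂ => exact .letin (ih₁ _) (ih₂ _)
  | proj _ ih => exact .proj (ih _)
  | app _ _ ih₁ ih₂ => exact .app (ih₁ _) (ih₂ _)
  | tapp _ ih => exact .tapp (ih _)
  | lapp _ ih => exact .lapp (ih _)

theorem Forced.localStep {Φ : FunMap} {N : Tm} (h : Forced P a M M') (hM : M.IsElim)
    (hs : LocalStep Φ M N) : M'.IsElim ∧ ∃ N', LocalStep Φ M' N' ∧ Forced P a N N' := by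
  cases h with
  | proj hV =>
    cases hs <;> cases hV
    case base h => exact h.monadic.elim
    case proj1.pair hV₁ _ => exact ⟨trivial, _, .proj1, hV₁⟩
    case base h => exact h.monadic.elim
    case proj2.pair _ hV₂ => exact ⟨trivial, _, .proj2, hV₂⟩
  | tapp hV =>
    cases hs
    cases hV with
    | base h => exact h.monadic.elim
    | tabs hV => exact ⟨trivial, _, .tapp, .unit (hV.inst _ _)⟩
  | app hV hW =>
    cases hs with
    | app hΦ hlen =>
    cases hV with
    | base h => exact h.monadic.elim
    | clo hl hWs =>
      exact ⟨trivial, _, .app hΦ (hl ▸ hlen), ((refl P a _).substs hl hWs _).subst hW _⟩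
  | lapp hV =>
    cases hs with
    | @lapp _ _ _ _ _ zs V hΦ hlen =>
    cases hV with
    | base h => exact h.monadic.elim
    | clo hl hWs =>
      refine ⟨trivial, _, .lapp hΦ (hl ▸ hlen), ?_⟩
      have hbody := (refl_val P a V).substs hl hWs zs
      rw [Val.substs_val, Val.substs_val] at hbody
      exact hbody.inst _ _
  | _ => exact hM.elim

theorem Forced.exists_val (h : Forced P a (.val V) M) : ∃ V', M = .val V' := by
  cases h <;> exact ⟨_, rfl⟩

theorem Forced.ev {Φ : FunMap} (h : Forced P a M M') (he : Ev Φ M V) :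
    ∃ V', Ev Φ M' V' ∧ Forced P a (.val V) (.val V') := by
  induction he generalizing M' with
  | val =>
    obtain ⟨V', rfl⟩ := h.exists_val
    exact ⟨V', .val, h⟩
  | letin _ _ ih₁ ih₂ =>
    cases h with
    | letin hM hN =>
      obtain ⟨V', heM, hV⟩ := ih₁ hM
      obtain ⟨W', heN, hW⟩ := ih₂ (hN.subst hV _)
      exact ⟨W', .letin heM heN, hW⟩
  | step hM hs _ ih =>
    obtain ⟨hM', N', hs', hN⟩ := h.localStep hM hs
    obtain ⟨V', he, hV⟩ := ih hN
    exact ⟨V', .step hM' hs' he, hV⟩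

theorem Movable.eq_of_forced (hV : Movable V) (h : Forced P a (.val V) (.val V')) : V = V' := by
  induction hV generalizing V' with
  | var =>
    cases h with
    | base h => exact h.monadic.elim
    | var => rfl
  | pair _ _ ih₁ ih₂ =>
    cases h with
    | base h => exact h.monadic.elim
    | pair hV hW => rw [ih₁ hV, ih₂ hW]
  | @clo Ws _ _ _ _ ih =>
    cases h with
    | base h => exact h.monadic.elim
    | @clo _ Ws' _ _ _ hlen h =>
      congr 1
      refine List.ext_getElem hlen fun i hi hi' => ih _ (List.getElem_mem hi) (h (Ws[i], Ws'[i]) ?_)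
      rw [← List.getElem_zip (h := by rw [List.length_zip]; exact lt_min hi hi')]
      exact List.getElem_mem _
  | tabs _ ih =>
    cases h with
    | base h => exact h.monadic.elim
    | tabs h => rw [ih h]

theorem Typing.eq_of_forced (h : Typing D 0 0 [] L (.val V) A) (hA : A.Reloc)
    (hf : Forced P a (.val V) (.val V')) : V = V' :=
  (h.movable hA).eq_of_forced hf

theorem Typing.forced_inv (h : Typing D 0 0 [] L (.val V) (.T A))
    (hf : Forced P a (.val V) (.val V')) :
    V' = V ∨ Forcing P a V V' ∨ ∃ x M N M' N', V = .bind x M N ∧ V' = .bind x M' N' ∧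
      Forced P a M M' ∧ Forced P a N N' := by
  cases hf with
  | base hb => exact .inr (.inl hb)
  | bind hM hN => exact .inr (.inr ⟨_, _, _, _, _, rfl, rfl, hM, hN⟩)
  | unit hf => cases h with | unit h hA => exact .inl (by rw [h.eq_of_forced hA hf])
  | var => exact .inl rfl
  | req hV hW =>
    cases h with
    | req h₁ h₂ hA => exact .inl (by rw [h₁.eq_of_forced trivial hV, h₂.eq_of_forced hA hW])
  | call hV hW =>
    cases h with
    | call h₁ h₂ hA => exact .inl (by rw [h₁.eq_of_forced trivial hV, h₂.eq_of_forced hA hW])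
  | gen hV hW =>
    cases h with
    | gen h₁ h₂ hA => exact .inl (by rw [h₁.eq_of_forced trivial hV, h₂.eq_of_forced hA hW])
  | pair | clo | tabs => nomatch h

theorem Forced.runVal (hP : P.WF D) (hf : Forced P a (.val V) (.val V')) (hr : RunVal P a V U)
    (h : Typing D 0 0 [] (.const a) (.val V) (.T A)) : RunVal P a V' U := by
  have hinv := h.forced_inv hf
  induction hr generalizing A V' with
  | bind heM hrM heN hrN ih₁ ih₂ =>
    obtain rfl | hb | ⟨_, _, _, _, _, ⟨⟩, rfl, hM, hN⟩ := hinv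
    · exact .bind heM hrM heN hrN
    · exact hb.run _ (.bind heM hrM heN hrN)
    cases h with
    | bind htM htN =>
      have htV := heM.typing hP htM
      have htV' := heN.typing hP (htN.subst_head hP.decomp_ok trivial (hrM.typing hP htV).1)
      obtain ⟨W, heM', hW⟩ := hM.ev heM
      obtain ⟨W', heN', hW'⟩ := (hN.subst (Forced.refl_val P _ _) _).ev heN
      exact .bind heM' (ih₁ hW htV (htV.forced_inv hW)) heN' (ih₂ hW' htV' (htV'.forced_inv hW'))
  | _ =>
    obtain rfl | hb | ⟨_, _, _, _, _, ⟨⟩, -⟩ := hinv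
    · constructor <;> assumption
    · refine hb.run _ ?_
      constructor <;> assumption

end Forced

/-! ### From reduction to big-step evaluation -/

section Contexts

variable {P : Program} {D : Decomp} {a : Side} {L : Loc} {M M' : Tm} {A : Ty} {R U : Val}

theorem ELet.typing_plug {E : ELet} (h : Typing D 0 0 [] L (E.plug M) A) :
    ∃ B, Typing D 0 0 [] L M B ∧
      ∀ M', Typing D 0 0 [] L M' B → Typing D 0 0 [] L (E.plug M') A := by
  induction E generalizing A with
  | hole => exact ⟨A, h, fun _ h => h⟩
  | letin x E N ih =>
    cases h with
    | letin hE hN =>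
      obtain ⟨B, hM, hplug⟩ := ih hE
      exact ⟨B, hM, fun M' h => .letin (hplug M' h) hN⟩

theorem ECtx.typing_plug {E : ECtx} (h : Typing D 0 0 [] L (E.plug M) A) :
    ∃ B, Typing D 0 0 [] L M B ∧
      ∀ M', Typing D 0 0 [] L M' B → Typing D 0 0 [] L (E.plug M') A := by
  induction E generalizing A with
  | ofLet E => exact E.typing_plug h
  | bind x E N ih =>
    cases h with
    | bind hE hN =>
      obtain ⟨B, hM, hplug⟩ := ih hE
      exact ⟨B, hM, fun M' h => .bind (hplug M' h) hN⟩

/-- Every value of `M'` is a value of `M` in which some computations have been forced. -/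
def EvForced (P : Program) (a : Side) (M' M : Tm) : Prop :=
  ∀ V, Ev (P.at a) M' V → ∃ V', Ev (P.at a) M V' ∧ Forced P a (.val V) (.val V')

theorem EvForced.of_ev (h : ∀ V, Ev (P.at a) M' V → Ev (P.at a) M V) : EvForced P a M' M :=
  fun V hV => ⟨V, h V hV, Forced.refl_val P a V⟩

theorem EvForced.of_run (hP : P.WF D) (hM' : Typing D 0 0 [] (.const a) M' (.T A))
    (hR : Typing D 0 0 [] L (.val R) (.T A)) (h : ∀ U, Run P a M' U → RunVal P a R U) :
    EvForced P a M' (.val R) := by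
  intro V hV
  have htV := hV.typing hP hM'
  exact ⟨R, .val, .base ⟨htV.monadic, htV.closed, hR.closed, fun U hU => h U ⟨V, hV, hU⟩⟩⟩

theorem EvForced.letPlug (h : EvForced P a M' M) (E : ELet) :
    EvForced P a (E.plug M') (E.plug M) := by
  induction E with
  | hole => exact h
  | letin x E N ih =>
    intro V hV
    cases hV with
    | letin heE heN =>
      obtain ⟨W, heE', hW⟩ := ih _ heE
      obtain ⟨V', heN', hV'⟩ := ((Forced.refl P a N).subst hW x).ev heN
      exact ⟨V', .letin heE' heN', hV'⟩
    | step hM => exact hM.elim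

theorem Run.val_iff {V : Val} : Run P a (.val V) U ↔ RunVal P a V U := by
  refine ⟨fun ⟨W, h, hr⟩ => ?_, fun h => ⟨V, .val, h⟩⟩
  rwa [h.val_inv] at hr

theorem Run.typing (hP : P.WF D) (hr : Run P a M U) (h : Typing D 0 0 [] (.const a) M (.T A)) :
    Typing D 0 0 [] (.const a) (.val U) A ∧ A.Reloc := by
  obtain ⟨V, he, hr⟩ := hr
  exact hr.typing hP (he.typing hP h)

theorem EvForced.run_plug (hP : P.WF D) (h : EvForced P a M' M) {E : ECtx}
    (ht : Typing D 0 0 [] (.const a) (E.plug M') (.T A)) (hr : Run P a (E.plug M') U) :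
    Run P a (E.plug M) U := by
  induction E generalizing A U with
  | ofLet E =>
    obtain ⟨V, he, hr⟩ := hr
    obtain ⟨V', he', hf⟩ := h.letPlug E V he
    exact ⟨V', he', hf.runVal hP hr (he.typing hP ht)⟩
  | bind x E N ih =>
    cases ht with
    | bind htE htN =>
      rw [ECtx.plug, Run.val_iff] at hr ⊢
      cases hr with
      | bind heE hrE heN hrN =>
        obtain ⟨V, heE', hrE'⟩ := ih htE ⟨_, heE, hrE⟩
        exact .bind heE' hrE' heN hrN

theorem LocalStep.evForced (hP : P.WF D) (hs : LocalStep (P.at a) M M')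
    (h : Typing D 0 0 [] (.const a) M A) : EvForced P a M' M := by
  cases hs with
  | letin => exact .of_ev fun V hV => .letin .val hV
  | bind =>
    have ⟨B, hA⟩ : ∃ B, A = .T B := by cases h; exact ⟨_, rfl⟩
    subst hA
    exact .of_run hP (LocalStep.bind.typing hP h) h fun U ⟨V, he, hr⟩ => .bind .val .unit he hr
  | proj1 => exact .of_ev fun V hV => .step trivial .proj1 hV
  | proj2 => exact .of_ev fun V hV => .step trivial .proj2 hV
  | tapp => exact .of_ev fun V hV => .step trivial .tapp hV
  | app hΦ hlen => exact .of_ev fun V hV => .step trivial (.app hΦ hlen) hV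
  | lapp hΦ hlen => exact .of_ev fun V hV => .step trivial (.lapp hΦ hlen) hV

end Contexts

section Configurations

variable {P : Program} {D : Decomp} {a : Side} {E : ECtx} {M M' : Tm} {A B : Ty} {V W U U' : Val}
  {Δc Δs : Stack} {C C' : Conf}

/-- The steps in an evaluation context at `a` that leave the stacks and the other side alone. -/
inductive SideStep (P : Program) : Side → Tm → Tm → Prop where
  | loc {a : Side} {M M' : Tm} : LocalStep (P.at a) M M' → SideStep P a M M'
  | gen {a : Side} {V W : Val} : SideStep P a (.val (.gen (.const a) V W)) (.app V W)
  | genReq {V W : Val} : SideStep P .c (.val (.gen (.const .s) V W)) (.val (.req V W))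
  | genCall {V W : Val} : SideStep P .s (.val (.gen (.const .c) V W)) (.val (.call V W))

theorem SideStep.typing (hP : P.WF D) (hs : SideStep P a M M')
    (h : Typing D 0 0 [] (.const a) M A) : Typing D 0 0 [] (.const a) M' A := by
  cases hs with
  | loc hs => exact hs.typing hP h
  | gen => cases h with | gen hV hW => exact .app hV hW
  | genReq => cases h with | gen hV hW hA => exact .req hV hW hA
  | genCall => cases h with | gen hV hW hA => exact .call hV hW hA

theorem SideStep.evForced (hP : P.WF D) (hs : SideStep P a M M')
    (h : Typing D 0 0 [] (.const a) M A) : EvForced P a M' M := by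
  have hM' := hs.typing hP h
  cases hs with
  | loc hs => exact hs.evForced hP h
  | gen => cases h with | gen hV hW hA hL =>
    exact .of_run hP hM' (.gen hV hW hA hL) fun U ⟨V, he, hr⟩ => .gen he hr
  | genReq => cases h with | gen hV hW hA hL =>
    exact .of_run hP hM' (.gen hV hW hA hL) fun U hU => .genReq (Run.val_iff.mp hU)
  | genCall => cases h with | gen hV hW hA hL =>
    exact .of_run hP hM' (.gen hV hW hA hL) fun U hU => .genCall (Run.val_iff.mp hU)

theorem SideStep.typing_plug (hP : P.WF D) (hs : SideStep P a M M')
    (h : Typing D 0 0 [] (.const a) (E.plug M) A) :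
    Typing D 0 0 [] (.const a) (E.plug M') A := by
  obtain ⟨B, hM, hE⟩ := E.typing_plug h
  exact hE M' (hs.typing hP hM)

theorem SideStep.run_plug (hP : P.WF D) (hs : SideStep P a M M')
    (h : Typing D 0 0 [] (.const a) (E.plug M) (.T A)) (hr : Run P a (E.plug M') U) :
    Run P a (E.plug M) U := by
  obtain ⟨B, hM, hE⟩ := E.typing_plug h
  exact (hs.evForced hP hM).run_plug hP (hE M' (hs.typing hP hM)) hr

theorem Run.plug_req (hP : P.WF D)
    (h : Typing D 0 0 [] (.const .c) (E.plug (.val (.req V W))) (.T A))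
    (hr : Run P .s (.app V W) U) (hr' : Run P .c (E.plug (.val (.unit U))) U') :
    Run P .c (E.plug (.val (.req V W))) U' := by
  obtain ⟨B, hM, hE⟩ := E.typing_plug h
  cases hM with
  | @req _ _ _ _ _ B hV hW hA =>
    obtain ⟨hU, hB⟩ := hr.typing hP (hV.app_of_remote hW hA)
    have hunit : Typing D 0 0 [] (.const .c) (.val (.unit U)) (.T B) := .unit (hU.relocate hB _) hB
    refine (EvForced.of_run hP hunit (.req hV hW hA) fun U₁ hU₁ => ?_).run_plug hP (hE _ hunit) hr'
    obtain ⟨V', he, hr⟩ := hr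
    cases Run.val_iff.mp hU₁
    exact .req he hr

theorem Run.plug_call (hP : P.WF D)
    (h : Typing D 0 0 [] (.const .s) (E.plug (.val (.call V W))) (.T A))
    (hr : Run P .c (.app V W) U) (hr' : Run P .s (E.plug (.val (.unit U))) U') :
    Run P .s (E.plug (.val (.call V W))) U' := by
  obtain ⟨B, hM, hE⟩ := E.typing_plug h
  cases hM with
  | @call _ _ _ _ _ B hV hW hA =>
    obtain ⟨hU, hB⟩ := hr.typing hP (hV.app_of_remote hW hA)
    have hunit : Typing D 0 0 [] (.const .s) (.val (.unit U)) (.T B) := .unit (hU.relocate hB _) hB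
    refine (EvForced.of_run hP hunit (.call hV hW hA) fun U₁ hU₁ => ?_).run_plug hP (hE _ hunit) hr'
    obtain ⟨V', he, hr⟩ := hr
    cases Run.val_iff.mp hU₁
    exact .call he hr

/-- `StackTyping D A a Δ Δ' B`: a computation of type `T B` running at `a`, with the stack `Δ` at
`a` and the stack `Δ'` at the other side, is part of a program of type `T A`. -/
inductive StackTyping (D : Decomp) (A : Ty) : Side → Stack → Stack → Ty → Prop where
  | nil : StackTyping D A .c [] [] A
  | client {E : ECtx} {Δc Δs : Stack} {B C : Ty} :
      (∀ M, Typing D 0 0 [] (.const .s) M (.T B) → Typing D 0 0 [] (.const .s) (E.plug M) (.T C)) →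
      StackTyping D A .s Δs Δc C → StackTyping D A .c Δc (E :: Δs) B
  | server {E : ECtx} {Δc Δs : Stack} {B C : Ty} :
      (∀ M, Typing D 0 0 [] (.const .c) M (.T B) → Typing D 0 0 [] (.const .c) (E.plug M) (.T C)) →
      StackTyping D A .c Δc Δs C → StackTyping D A .s Δs (E :: Δc) B

/-- `ConfTyping D A C`: the configuration `C` is part of the run of a program of type `T A`. -/
def ConfTyping (D : Decomp) (A : Ty) : Conf → Prop
  | .client M Δc Δs => ∃ B, Typing D 0 0 [] (.const .c) M (.T B) ∧ StackTyping D A .c Δc Δs B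
  | .server Δc M Δs => ∃ B, Typing D 0 0 [] (.const .s) M (.T B) ∧ StackTyping D A .s Δs Δc B

theorem Step.confTyping (hP : P.WF D) (hs : Step P C C') (h : ConfTyping D A C) :
    ConfTyping D A C' := by
  have side {a : Side} {E : ECtx} {M M' : Tm} {B : Ty} (hs : SideStep P a M M') :
      Typing D 0 0 [] (.const a) (E.plug M) B → Typing D 0 0 [] (.const a) (E.plug M') B :=
    hs.typing_plug hP
  cases hs <;> obtain ⟨B, h, hΔ⟩ := h
  case localC hs => exact ⟨B, side (a := .c) (.loc hs) h, hΔ⟩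
  case localS hs => exact ⟨B, side (a := .s) (.loc hs) h, hΔ⟩
  case genCC => exact ⟨B, side .gen h, hΔ⟩
  case genSC => exact ⟨B, side .genReq h, hΔ⟩
  case genCS => exact ⟨B, side .genCall h, hΔ⟩
  case genSS => exact ⟨B, side .gen h, hΔ⟩
  case req =>
    obtain ⟨B', h, hE⟩ := ECtx.typing_plug h
    cases h with
    | req hV hW hA => exact ⟨_, hV.app_of_remote hW hA, .server hE hΔ⟩
  case call =>
    obtain ⟨B', h, hE⟩ := ECtx.typing_plug h
    cases h with
    | call hV hW hA => exact ⟨_, hV.app_of_remote hW hA, .client hE hΔ⟩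
  case unitC =>
    cases h with
    | unit h hr => cases hΔ with | client hE hΔ => exact ⟨_, hE _ (.unit (h.relocate hr _) hr), hΔ⟩
  case unitS =>
    cases h with
    | unit h hr => cases hΔ with | server hE hΔ => exact ⟨_, hE _ (.unit (h.relocate hr _) hr), hΔ⟩
  case unitSE => cases hΔ

/-- `ConfRun P C U`: the configuration `C` returns `U`, where the running term and, one after the
other, the contexts on the stacks are evaluated by `Run`. -/
inductive ConfRun (P : Program) : Conf → Val → Prop where
  | done {M : Tm} {U : Val} : Run P .c M U → ConfRun P (.client M [] []) U
  | client {M : Tm} {E : ECtx} {Δc Δs : Stack} {U₁ U : Val} : Run P .c M U₁ →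
      ConfRun P (.server Δc (E.plug (.val (.unit U₁))) Δs) U →
      ConfRun P (.client M Δc (E :: Δs)) U
  | server {M : Tm} {E : ECtx} {Δc Δs : Stack} {U₁ U : Val} : Run P .s M U₁ →
      ConfRun P (.client (E.plug (.val (.unit U₁))) Δc Δs) U →
      ConfRun P (.server (E :: Δc) M Δs) U

theorem ConfRun.replace_client (h : ConfRun P (.client M' Δc Δs) U)
    (hr : ∀ U, Run P .c M' U → Run P .c M U) : ConfRun P (.client M Δc Δs) U := by
  cases h with
  | done h => exact .done (hr _ h)
  | client h h' => exact .client (hr _ h) h'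

theorem ConfRun.replace_server (h : ConfRun P (.server Δc M' Δs) U)
    (hr : ∀ U, Run P .s M' U → Run P .s M U) : ConfRun P (.server Δc M Δs) U := by
  cases h with
  | server h h' => exact .server (hr _ h) h'

theorem ConfRun.of_step (hP : P.WF D) (hs : Step P C C') (h : ConfTyping D A C)
    (hr : ConfRun P C' U) : ConfRun P C U := by
  have side {a : Side} {E : ECtx} {M M' : Tm} {B : Ty} (hs : SideStep P a M M')
      (h : Typing D 0 0 [] (.const a) (E.plug M) (.T B)) (U : Val) :
      Run P a (E.plug M') U → Run P a (E.plug M) U := hs.run_plug hP h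
  cases hs <;> obtain ⟨B, h, hΔ⟩ := h
  case localC hs => exact hr.replace_client (side (a := .c) (.loc hs) h)
  case localS hs => exact hr.replace_server (side (a := .s) (.loc hs) h)
  case genCC => exact hr.replace_client (side .gen h)
  case genSC => exact hr.replace_client (side .genReq h)
  case genCS => exact hr.replace_server (side .genCall h)
  case genSS => exact hr.replace_server (side .gen h)
  case req =>
    cases hr with
    | server hr₁ hr₂ => exact hr₂.replace_client fun _ => hr₁.plug_req hP h
  case call =>
    obtain ⟨_, hM, _⟩ := ECtx.typing_plug h
    cases hM
    cases hr with
    | client hr₁ hr₂ => exact hr₂.replace_server fun _ => hr₁.plug_call hP h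
  case unitC => exact .client (Run.val_iff.mpr .unit) hr
  case unitS => exact .server (Run.val_iff.mpr .unit) hr
  case unitSE => cases hΔ

theorem run_of_steps (hP : P.WF D) (hM : Typing D 0 0 [] (.const .c) M (.T A))
    (hred : Relation.ReflTransGen (Step P) (.client M [] []) (.client (.val (.unit V)) [] [])) :
    Run P .c M V := by
  have hconf {C : Conf} (hC : Relation.ReflTransGen (Step P) C (.client (.val (.unit V)) [] [])) :
      ConfTyping D A C → ConfRun P C V := by
    induction hC using Relation.ReflTransGen.head_induction_on with
    | refl => exact fun _ => .done (Run.val_iff.mpr .unit)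
    | head hs _ ih => exact fun h => .of_step hP hs h (ih (hs.confTyping hP h))
  cases hconf hred ⟨A, hM, .nil⟩ with
  | done h => exact h

end Configurations

/-! ### Compilation and substitution -/

theorem Val.compList_eq_map (a : Side) (Vs : List Val) :
    Val.compList a Vs = Vs.map (Val.comp a) := by
  induction Vs with
  | nil => rfl
  | cons V Vs ih => rw [compList, ih, List.map_cons]

theorem UVal.substList_eq_map (vs : List UVal) (x : UVar) (u : UVal) :
    UVal.substList vs x u = vs.map fun v => v.subst x u := by
  induction vs with
  | nil => rfl
  | cons v vs ih => rw [substList, ih, List.map_cons]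

theorem UTm.substs_append (m : UTm) {xs ys : List UVar} {vs ws : List UVal}
    (h : xs.length = vs.length) :
    m.substs (xs ++ ys) (vs ++ ws) = (m.substs xs vs).substs ys ws := by
  simp only [UTm.substs, List.zip_append h, List.foldl_append]

theorem remoteCall_subst (v w : UVal) (x : UVar) (u : UVal) :
    (remoteCall v w).subst x u = remoteCall (v.subst x u) (w.subst x u) := by
  simp [remoteCall, sendThen, UVal.subst, UTm.subst, UVal.substList]

theorem genCall_subst (a : Side) (l v w : UVal) (x : UVar) (u : UVal) :
    (genCall a l v w).subst x u = genCall a (l.subst x u) (v.subst x u) (w.subst x u) := by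
  by_cases hx : x = .tm 0 <;> cases a <;>
    simp [genCall, bindUnit, ifClient, UVal.subst, UTm.subst, Branches.subst, hx, remoteCall_subst]

theorem Loc.comp_subst_tm (L : Loc) (x : Name) (u : UVal) : L.comp.subst (.tm x) u = L.comp := by
  match L with
  | .const .c | .const .s => rfl
  | .var l => simp [Loc.comp, UVal.subst]

theorem Loc.comp_subst {k : ℕ} {u : UVal} {σ σ' : ℕ → Loc}
    (h : ∀ i, (σ' i).comp = (σ i).comp.subst (.loc k) u) (L : Loc) :
    (L.subst σ').comp = (L.subst σ).comp.subst (.loc k) u := by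
  match L with
  | .const .c | .const .s => rfl
  | .var i => exact h i

theorem Loc.comp_subst_update (k : ℕ) (L' L : Loc) :
    (L.subst (Function.update Loc.var k L')).comp = L.comp.subst (.loc k) L'.comp := by
  match L with
  | .const .c | .const .s => rfl
  | .var i =>
    rcases eq_or_ne i k with rfl | h
    · simp [Loc.subst, Loc.comp, UVal.subst]
    · simp [Loc.subst, Loc.comp, UVal.subst, Function.update_of_ne h, h.symm]

mutual
  theorem Val.comp_subst (a : Side) (x : Name) (U : Val) : ∀ V : Val,
      (V.subst x U).comp a = (V.comp a).subst (.tm x) (U.comp a)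
    | .var y => by by_cases h : x = y <;> simp [Val.comp, UVal.subst, Val.subst, h]
    | .clo Ws _ Ls _ => by
      have hLs : (Ls.map Loc.comp).map (fun v => v.subst (.tm x) (U.comp a)) = Ls.map Loc.comp :=
        List.map_map.trans (List.map_congr_left fun L _ => L.comp_subst_tm x _)
      simp only [Val.subst, Val.comp, UVal.subst, Val.comp_substList a x U Ws,
        UVal.substList_eq_map, List.map_append, hLs]
    | .tabs V | .unit V => by simp [Val.comp, UVal.subst, Val.subst, Val.comp_subst a x U V]
    | .bind y M N => by
      simp [Val.comp, UVal.subst, Val.subst, apply_ite (Tm.comp a), Tm.comp_subst a x U M,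
        Tm.comp_subst a x U N]
    | .pair V W | .req V W | .call V W => by
      simp [Val.comp, UVal.subst, remoteCall_subst, Val.subst, Val.comp_subst a x U V,
        Val.comp_subst a x U W]
    | .gen L V W => by
      simp [Val.comp, genCall_subst, Val.subst, Loc.comp_subst_tm, Val.comp_subst a x U V,
        Val.comp_subst a x U W]
  theorem Val.comp_substList (a : Side) (x : Name) (U : Val) : ∀ Vs : List Val,
      Val.compList a (Val.substList Vs x U) = UVal.substList (Val.compList a Vs) (.tm x) (U.comp a)
    | [] => rfl
    | V :: Vs => by
      simp [Val.compList, UVal.substList, Val.substList, Val.comp_subst a x U V,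
        Val.comp_substList a x U Vs]
  theorem Tm.comp_subst (a : Side) (x : Name) (U : Val) : ∀ M : Tm,
      (M.subst x U).comp a = (M.comp a).subst (.tm x) (U.comp a)
    | .letin y M N => by
      simp [Tm.comp, UTm.subst, Tm.subst, apply_ite (Tm.comp a), Tm.comp_subst a x U M,
        Tm.comp_subst a x U N]
    | .val V | .proj _ V | .tapp V _ => by
      simp [Tm.comp, UVal.subst, UTm.subst, Tm.subst, Val.comp_subst a x U V]
    | .app V W => by
      simp [Tm.comp, UTm.subst, Tm.subst, Val.comp_subst a x U V, Val.comp_subst a x U W]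
    | .lapp V L => by simp [Tm.comp, UTm.subst, Tm.subst, Loc.comp_subst_tm, Val.comp_subst a x U V]
end

mutual
  theorem Val.comp_inst {k : ℕ} {u : UVal} {σ σ' : ℕ → Loc} (a : Side)
      (h : ∀ i, (σ' i).comp = (σ i).comp.subst (.loc k) u) : ∀ (V : Val) (σt : ℕ → Ty),
      (V.inst σ' σt).comp a = ((V.inst σ σt).comp a).subst (.loc k) u
    | .var y, _ => by simp [Val.comp, UVal.subst, Val.inst]
    | .clo Ws _ Ls _, σt => by
      simp [Val.comp, UVal.subst, Val.inst, Val.comp_instList a h Ws σt, UVal.substList_eq_map,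
        Loc.comp_subst h]
    | .tabs V, σt => by simp [Val.comp, Val.inst, Val.comp_inst a h V (Ty.liftT σt)]
    | .unit V, σt => by simp [Val.comp, UVal.subst, Val.inst, Val.comp_inst a h V σt]
    | .bind y M N, σt => by
      simp [Val.comp, UVal.subst, Val.inst, Tm.comp_inst a h M σt, Tm.comp_inst a h N σt]
    | .pair V W, σt | .req V W, σt | .call V W, σt => by
      simp [Val.comp, UVal.subst, remoteCall_subst, Val.inst, Val.comp_inst a h V σt,
        Val.comp_inst a h W σt]
    | .gen L V W, σt => by
      simp [Val.comp, genCall_subst, Val.inst, Loc.comp_subst h, Val.comp_inst a h V σt,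
        Val.comp_inst a h W σt]
  theorem Val.comp_instList {k : ℕ} {u : UVal} {σ σ' : ℕ → Loc} (a : Side)
      (h : ∀ i, (σ' i).comp = (σ i).comp.subst (.loc k) u) : ∀ (Vs : List Val) (σt : ℕ → Ty),
      Val.compList a (Val.instList σ' σt Vs)
        = UVal.substList (Val.compList a (Val.instList σ σt Vs)) (.loc k) u
    | [], _ => rfl
    | V :: Vs, σt => by
      simp [Val.compList, UVal.substList, Val.instList, Val.comp_inst a h V σt,
        Val.comp_instList a h Vs σt]
  theorem Tm.comp_inst {k : ℕ} {u : UVal} {σ σ' : ℕ → Loc} (a : Side)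
      (h : ∀ i, (σ' i).comp = (σ i).comp.subst (.loc k) u) : ∀ (M : Tm) (σt : ℕ → Ty),
      (M.inst σ' σt).comp a = ((M.inst σ σt).comp a).subst (.loc k) u
    | .letin y M N, σt => by
      simp [Tm.comp, UTm.subst, Tm.inst, Tm.comp_inst a h M σt, Tm.comp_inst a h N σt]
    | .val V, σt | .proj _ V, σt | .tapp V _, σt => by
      simp [Tm.comp, UVal.subst, UTm.subst, Tm.inst, Val.comp_inst a h V σt]
    | .app V W, σt => by
      simp [Tm.comp, UTm.subst, Tm.inst, Val.comp_inst a h V σt, Val.comp_inst a h W σt]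
    | .lapp V L, σt => by
      simp [Tm.comp, UTm.subst, Tm.inst, Loc.comp_subst h, Val.comp_inst a h V σt]
end

theorem Tm.comp_substs (a : Side) (M : Tm) (zs : List Name) (Ws : List Val) :
    (M.substs zs Ws).comp a = (M.comp a).substs (zs.map UVar.tm) (Ws.map (Val.comp a)) := by
  simp only [Tm.substs, UTm.substs, List.zip_map]
  induction zs.zip Ws generalizing M with
  | nil => rfl
  | cons p ps ih => simp only [List.foldl_cons, List.map_cons, ih, Tm.comp_subst, Prod.map]

/-- The substitution that replaces the variables `ks` by the locations `Ls`. -/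
def Loc.assign (ks : List ℕ) (Ls : List Loc) (i : ℕ) : Loc :=
  ((ks.zip Ls).lookup i).getD (.var i)

theorem Loc.assign_cons (k : ℕ) (ks : List ℕ) (L : Loc) (Ls : List Loc) (i : ℕ) :
    assign (k :: ks) (L :: Ls) i = if i = k then L else assign ks Ls i := by
  rw [assign, List.zip_cons_cons, List.lookup_cons]
  split <;> simp_all [assign]

theorem Loc.assign_nil_right (ks : List ℕ) : assign ks [] = Loc.var := by
  cases ks <;> rfl

theorem Loc.assign_range' {Ls : List Loc} {i : ℕ} (hi : i < Ls.length) (s : ℕ) :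
    assign (List.range' s Ls.length) Ls (s + i) = Ls[i] := by
  induction Ls generalizing s i with
  | nil => exact absurd hi (Nat.not_lt_zero i)
  | cons L Ls ih =>
    rw [List.length_cons, List.range'_succ, assign_cons]
    cases i with
    | zero => simp
    | succ i =>
      rw [if_neg (by omega), show s + (i + 1) = s + 1 + i by omega, List.getElem_cons_succ]
      exact ih (Nat.lt_of_succ_lt_succ hi) (s + 1)

theorem Loc.assign_eq_var {ks : List ℕ} {i : ℕ} (hi : i ∉ ks) (Ls : List Loc) :
    assign ks Ls i = .var i := by
  rw [assign, lookup_zip_eq_none Ls hi, Option.getD_none]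

/-- The successive substitution on the left amounts to a simultaneous one because the `Ls` are
closed. -/
theorem Tm.comp_substs_loc (a : Side) (M : Tm) (σ : ℕ → Loc) (σt : ℕ → Ty) (ks : List ℕ)
    {Ls : List Loc} (hLs : ∀ L ∈ Ls, L.WF 0) :
    ((M.inst σ σt).comp a).substs (ks.map UVar.loc) (Ls.map Loc.comp)
      = (M.inst (fun i => (σ i).subst (Loc.assign ks Ls)) σt).comp a := by
  induction ks generalizing Ls σ with
  | nil =>
    change _ = (M.inst (fun i => (σ i).subst Loc.var) σt).comp a
    simp only [Loc.subst_var]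
    rfl
  | cons k ks ih =>
    cases Ls with
    | nil =>
      simp only [Loc.assign_nil_right, Loc.subst_var]
      rfl
    | cons L Ls =>
      obtain ⟨hL, hLs⟩ := List.forall_mem_cons.mp hLs
      have hcomp (i : ℕ) : (Function.update Loc.var k L i).subst (Loc.assign ks Ls)
          = Loc.assign (k :: ks) (L :: Ls) i := by
        rw [Loc.assign_cons, Function.update_apply]
        split
        · rw [Loc.subst_congr hL (σ' := Loc.var) (by simp), Loc.subst_var]
        · rfl
      have hstep := Tm.comp_inst a (fun i => Loc.comp_subst_update k L (σ i)) M σt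
      refine (congrArg (UTm.substs · _ _) hstep.symm).trans ?_
      simp only [ih _ hLs, Loc.subst_subst, hcomp]

theorem Typing.comp_inst_congr {D : Decomp} {nl nt : ℕ} {Γ : Ctx} {L : Loc} {M : Tm} {A : Ty}
    (h : Typing D nl nt Γ L M A) (a : Side) {σl σl' : ℕ → Loc} (hl : ∀ i < nl, σl i = σl' i)
    (σt σt' : ℕ → Ty) : (M.inst σl σt).comp a = (M.inst σl' σt').comp a := by
  induction h generalizing σt σt' with
  | var => rfl
  | clo hF hlen _ ih =>
    obtain ⟨_, _, hargs, _⟩ := funTyping_iff.mp hF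
    simp only [Tm.inst, Val.inst, Tm.comp, Val.comp, Val.instList_eq_map, Val.compList_eq_map,
      List.map_map]
    congr 3
    · exact List.map_congr_left fun L hL => congrArg Loc.comp (Loc.subst_congr (hargs.locs L hL) hl)
    · refine List.map_congr_left fun W hW => ?_
      obtain ⟨B, hB⟩ := exists_mem_zip_of_mem_left hlen hW
      exact UTm.val.inj (ih _ hB σt σt')
  | tabs _ ih =>
    simpa [Tm.inst, Tm.comp, Val.inst, Val.comp] using
      ih (.const .c) trivial (Ty.liftT σt) (Ty.liftT σt')
  | proj1 _ ih | proj2 _ ih | tapp _ _ _ ih | unit _ _ ih =>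
    simpa [Tm.inst, Tm.comp, Val.inst, Val.comp] using ih σt σt'
  | lapp _ hL ih =>
    simpa [Tm.inst, Tm.comp, Loc.subst_congr hL hl] using ih σt σt'
  | letin _ _ ih₁ ih₂ | bind _ _ ih₁ ih₂ | pair _ _ ih₁ ih₂ | app _ _ ih₁ ih₂ =>
    simpa [Tm.inst, Tm.comp, Val.inst, Val.comp] using And.intro (ih₁ σt σt') (ih₂ σt σt')
  | gen _ _ _ hL ih₁ ih₂ =>
    have hV := UTm.val.inj (ih₁ σt σt')
    have hW := UTm.val.inj (ih₂ σt σt')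
    simp only [Tm.inst, Tm.comp, Val.inst, Val.comp, hV, hW, Loc.subst_congr hL hl]
  | req _ _ _ ih₁ ih₂ | call _ _ _ ih₁ ih₂ =>
    have hV := UTm.val.inj (ih₁ σt σt')
    have hW := UTm.val.inj (ih₂ σt σt')
    simp only [Tm.inst, Tm.comp, Val.inst, Val.comp, hV, hW]

theorem Typing.comp_substs_loc {D : Decomp} {nl nt : ℕ} {Γ : Ctx} {L : Loc} {M : Tm} {A : Ty}
    (h : Typing D nl nt Γ L M A) (a : Side) {ks : List ℕ} {Ls : List Loc}
    (hLs : ∀ L ∈ Ls, L.WF 0) {σ : ℕ → Loc} (σt : ℕ → Ty)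
    (hσ : ∀ i < nl, Loc.assign ks Ls i = σ i) :
    (M.comp a).substs (ks.map UVar.loc) (Ls.map Loc.comp) = (M.inst σ σt).comp a :=
  calc (M.comp a).substs (ks.map UVar.loc) (Ls.map Loc.comp)
    _ = ((M.inst Loc.var Ty.var).comp a).substs (ks.map UVar.loc) (Ls.map Loc.comp) := by
      rw [h.inst_eq_self (fun _ _ => rfl) (fun _ _ => rfl)]
    _ = (M.inst (Loc.assign ks Ls) Ty.var).comp a := Tm.comp_substs_loc a M _ _ ks hLs
    _ = (M.inst σ σt).comp a := h.comp_inst_congr a hσ _ _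

theorem Movable.comp_eq {V : Val} (h : Movable V) (a b : Side) : V.comp a = V.comp b := by
  induction h with
  | var => rfl
  | pair _ _ ih₁ ih₂ => simp only [Val.comp, ih₁, ih₂]
  | clo _ ih => simp only [Val.comp, Val.compList_eq_map, List.map_congr_left ih]
  | tabs _ ih => exact ih

/-! ### Compilation and local reduction -/

/-- The function map of a target program at a side. -/
def UProgram.at (p : UProgram) : Side → UFunMap
  | .c => p.client
  | .s => p.server

theorem Program.comp_at (P : Program) (a : Side) (F : FName) :
    P.comp.at a F = (P.at a F).map (FunDef.comp a) := by
  cases a <;> rfl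

section LocalStep

variable {P : Program} {D : Decomp} {nt : ℕ} {F : FName} {d : FunDef} {Ls : List Loc}
  {As : List Ty} {a : Side} {x : Name} {M M' : Tm} {V : Val} {A : Ty}

theorem BindingOK.comp_lam (hd : BindingOK D F d) (hargs : ArgsOK 0 nt d Ls As)
    (hcode : d.code.inst Ls As = .lam x M) (a : Side) :
    ∃ m, d.comp a
        = ⟨(List.range' 0 Ls.length).map UVar.loc ++ d.zs.map UVar.tm, .tm x, m⟩ ∧
      m.substs ((List.range' 0 Ls.length).map UVar.loc) (Ls.map Loc.comp) = M.comp a := by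
  cases hd with
  | labs _ hcode' =>
    rw [hcode'] at hcode
    exact nomatch hcode
  | @abs _ _ _ _ M₀ _ hcode' _ _ _ _ _ hM =>
    rw [hcode'] at hcode
    cases hcode
    refine ⟨M₀.comp a, by simp only [FunDef.comp, hcode', hargs.length_locs, List.range_eq_range'],
      ?_⟩
    refine hM.comp_substs_loc a hargs.locs _ fun i hi => ?_
    rw [← hargs.length_locs] at hi
    rw [ofList_of_lt _ _ hi, ← Loc.assign_range' hi 0, Nat.zero_add]

theorem BindingOK.comp_llam (hd : BindingOK D F d) (hargs : ArgsOK 0 nt d Ls As)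
    (hcode : d.code.inst Ls As = .llam V) (a : Side) :
    ∃ m, d.comp a
        = ⟨(List.range' 1 Ls.length).map UVar.loc ++ d.zs.map UVar.tm, .loc 0, m⟩ ∧
      m.substs ((List.range' 1 Ls.length).map UVar.loc) (Ls.map Loc.comp) = .val (V.comp a) := by
  cases hd with
  | abs _ hcode' =>
    rw [hcode'] at hcode
    exact nomatch hcode
  | @labs _ V₀ _ hcode' _ _ _ _ _ hV =>
    rw [hcode'] at hcode
    cases hcode
    refine ⟨(Tm.val V₀).comp a, ?_, ?_⟩
    · simp only [FunDef.comp, hcode', hargs.length_locs, List.range'_eq_map_range, List.map_map,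
        Function.comp_def, Nat.add_comm 1, Tm.comp]
    · refine (hV (.const a) trivial).comp_substs_loc a hargs.locs _ ?_
      rintro (_ | i) hi
      · exact Loc.assign_eq_var (by simp) Ls
      · rw [Nat.add_lt_add_iff_right, ← hargs.length_locs] at hi
        calc Loc.assign (List.range' 1 Ls.length) Ls (i + 1)
          _ = Ls[i] := by rw [Nat.add_comm, Loc.assign_range' hi 1]
          _ = (ofList Loc.var Ls i).ren Nat.succ := by
            rw [ofList_of_lt _ _ hi, Loc.ren_eq_subst,
              Loc.subst_congr (hargs.locs _ (List.getElem_mem hi)) (σ' := Loc.var) (by simp),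
              Loc.subst_var]

theorem ULocalStep.closure {Ws : List Val} {ks : List ℕ} {y : UVar} {m : UTm} {v : UVal}
    (hF : P.at a F = some d)
    (hd : d.comp a = ⟨ks.map UVar.loc ++ d.zs.map UVar.tm, y, m⟩)
    (hLs : Ls.length = ks.length) (hWs : Ws.length = d.zs.length) :
    ULocalStep (P.comp.at a) (.app ((Val.clo Ws F Ls As).comp a) v)
      (((m.substs (ks.map UVar.loc) (Ls.map Loc.comp)).substs (d.zs.map UVar.tm)
        (Ws.map (Val.comp a))).subst y v) := by
  have hf : P.comp.at a F = some (d.comp a) := by rw [P.comp_at, hF, Option.map_some]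
  rw [hd] at hf
  rw [← UTm.substs_append _ (by simp [hLs]), Val.comp, Val.compList_eq_map]
  exact .app hf (by simp [hLs, hWs])

theorem Typing.comp_instL {Γ : Ctx} {L : Loc} (h : Typing D 1 nt Γ L (.val V) A) (a b : Side) :
    ((Tm.val V).comp a).subst (.loc 0) (Loc.const b).comp
      = (Tm.val (V.instL (.const b))).comp a := by
  refine h.comp_substs_loc a (ks := [0]) (Ls := [.const b]) (by simp [Loc.WF]) Ty.var fun i hi => ?_
  obtain rfl := Nat.lt_one_iff.mp hi
  rfl

/-- Type applications are erased, which is why a source step may take no target step. -/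
theorem LocalStep.comp (hP : P.WF D) (hM : M.IsElim) (hs : LocalStep (P.at a) M M')
    (h : Typing D 0 0 [] (.const a) M A) :
    M.comp a = M'.comp a ∨ ULocalStep (P.comp.at a) (M.comp a) (M'.comp a) := by
  cases hs with
  | letin | bind => exact hM.elim
  | proj1 => exact .inr .proj1
  | proj2 => exact .inr .proj2
  | @tapp V A =>
    cases h with
    | tapp h =>
      cases h with
      | tabs h =>
        refine .inl ?_
        have hbody := h (.const a) trivial
        have hinst := hbody.comp_inst_congr a (σl' := Loc.var) (fun _ _ => rfl) Ty.var
          (ofList Ty.var [A])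
        rwa [hbody.inst_eq_self (fun _ _ => rfl) (fun _ _ => rfl)] at hinst
  | @app Ws F Ls As V zs x M hΦ hlen =>
    cases h with
    | app hV hW =>
      obtain ⟨d, hF, hd, hargs, -, rfl, hcode, -⟩ := hV.clo_lookup hP hΦ
      obtain ⟨m, hm, hsubst⟩ := hd.comp_lam hargs hcode.symm a
      have hstep := ULocalStep.closure (As := As) (v := V.comp a) hF hm List.length_range'.symm hlen
      rw [hsubst, ← Tm.comp_substs, ← Tm.comp_subst] at hstep
      exact .inr hstep
  | @lapp Ws F Ls As b zs V hΦ hlen =>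
    cases h with
    | lapp hV =>
      obtain ⟨d, hF, hd, hargs, -, rfl, hcode, -⟩ := hV.clo_lookup hP hΦ
      obtain ⟨m, hm, hsubst⟩ := hd.comp_llam hargs hcode.symm a
      have hstep := ULocalStep.closure (As := As) (v := (Loc.const b).comp) hF hm
        List.length_range'.symm hlen
      rw [hsubst, ← Tm.comp, ← Tm.comp_substs, Val.substs_val,
        (hV.llam_body hP hΦ).comp_instL] at hstep
      exact .inr hstep

end LocalStep

/-! ### Simulation by the compiled program -/

/-- The side with which `a` communicates. -/
def Side.other : Side → Side
  | .c => .s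
  | .s => .c

/-- The target configuration with `m` at `a` and `n` at the other side. -/
def UConf.mkAt : Side → UTm → UTm → UConf
  | .c, m, n => ⟨m, n⟩
  | .s, m, n => ⟨n, m⟩

theorem UConf.mkAt_other (a : Side) (m n : UTm) : mkAt a.other m n = mkAt a n m := by
  cases a <;> rfl

theorem UStep.comm_at (p : UProgram) (a : Side) (v : UVal) (e e₂ : UECtx) :
    UStep p (.mkAt a (e.plug (.val (sendThen v (.val .loop)))) (e₂.plug (.val .loop)))
      (.mkAt a (e.plug (.val .loop)) (e₂.plug (loopCase.subst (.tm 0) v))) := by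
  cases a with
  | c => exact .commCS (fun _ => rfl) .loop
  | s => exact .commSC .loop (fun _ => rfl)

/-- Composition of an evaluation context with `let x = [ ] in m`. -/
def UELet.snocLet (x : UVar) (m : UTm) : UELet → UELet
  | .hole => .letin x .hole m
  | .letin y e n => .letin y (e.snocLet x m) n

/-- Composition of an evaluation context with `let x = [ ] in m`. -/
def UECtx.snocLet (x : UVar) (m : UTm) : UECtx → UECtx
  | .ofLet e => .ofLet (e.snocLet x m)
  | .bind y e n => .bind y (e.snocLet x m) n

theorem UELet.plug_snocLet (e : UELet) (x : UVar) (m n : UTm) :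
    (e.snocLet x m).plug n = e.plug (.letin x n m) := by
  induction e with
  | hole => rfl
  | letin y e k ih => simp only [snocLet, plug, ih]

theorem UECtx.plug_snocLet (e : UECtx) (x : UVar) (m n : UTm) :
    (e.snocLet x m).plug n = e.plug (.letin x n m) := by
  induction e with
  | ofLet e => exact e.plug_snocLet x m n
  | bind y e k ih => simp only [snocLet, plug, ih]

/-- The evaluation context of a stack of monadic continuations, the outermost first. -/
def bindCtx : List (UVar × UTm) → UECtx
  | [] => .ofLet .hole
  | (x, m) :: k => .bind x (bindCtx k) m

theorem bindCtx_append_plug (k : List (UVar × UTm)) (x : UVar) (m n : UTm) :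
    (bindCtx (k ++ [(x, m)])).plug n = (bindCtx k).plug (.val (.bind x n m)) := by
  induction k with
  | nil => rfl
  | cons q k ih => simp only [List.cons_append, bindCtx, UECtx.plug, ih]

/-- Inside `e`, the term `m` at `a` reduces to `n`, possibly with the help of the other side, which
waits in `e₂` before and after. -/
def Reduces (p : UProgram) (a : Side) (e e₂ : UECtx) (m n : UTm) : Prop :=
  Relation.ReflTransGen (UStep p) (.mkAt a (e.plug m) (e₂.plug (.val .loop)))
    (.mkAt a (e.plug n) (e₂.plug (.val .loop)))

section Reduces

variable {p : UProgram} {a : Side} {e e₂ : UECtx} {k k₂ : List (UVar × UTm)} {m m₁ m₂ n : UTm}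
  {u v w : UVal} {x : UVar}

theorem Reduces.of_local (h : ULocalStep (p.at a) m n) : Reduces p a e e₂ m n := by
  cases a with
  | c => exact .single (.localC h .loop)
  | s => exact .single (.localS h .loop)

theorem Reduces.letin (h : ∀ e, Reduces p a e e₂ m (.val v)) :
    Reduces p a e e₂ (.letin x m n) (n.subst x v) := by
  have hm := h (e.snocLet x n)
  rw [Reduces, UECtx.plug_snocLet, UECtx.plug_snocLet] at hm
  exact hm.trans (Reduces.of_local .letin)

theorem Reduces.bind (h : ∀ k, Reduces p a (bindCtx k) e₂ m (.val (.unit u))) :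
    Reduces p a (bindCtx k) e₂ (.val (.bind x m n)) (n.subst x u) := by
  have hm := h (k ++ [(x, n)])
  rw [Reduces, bindCtx_append_plug, bindCtx_append_plug] at hm
  exact hm.trans (Reduces.of_local .bind)

theorem ULocalStep.ifClient_client (φ : UFunMap) (m₁ m₂ : UTm) :
    ULocalStep φ (ifClient (Loc.const .c).comp m₁ m₂) m₁ :=
  .case (vs := []) (xs := []) rfl rfl

theorem ULocalStep.ifClient_server (φ : UFunMap) (m₁ m₂ : UTm) :
    ULocalStep φ (ifClient (Loc.const .s).comp m₁ m₂) m₂ :=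
  .case (vs := []) (xs := []) rfl rfl

theorem Reduces.bindUnit_of_local (hm : ULocalStep (p.at a) m n)
    (h : ∀ k, Reduces p a (bindCtx k) e₂ n (.val (.unit u))) :
    Reduces p a (bindCtx k) e₂ (.val (bindUnit m)) (.val (.unit u)) :=
  Reduces.bind (n := .val (.unit (.var (.tm 0)))) fun k => .trans (Reduces.of_local hm) (h k)

theorem Reduces.genCall_self (h : ∀ k, Reduces p a (bindCtx k) e₂ (.app v w) (.val (.unit u))) :
    Reduces p a (bindCtx k) e₂ (.val (genCall a (Loc.const a).comp v w)) (.val (.unit u)) := by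
  cases a with
  | c => exact .bindUnit_of_local (.ifClient_client _ _ _) h
  | s => exact .bindUnit_of_local (.ifClient_server _ _ _) h

theorem ULocalStep.loopCase_ret (φ : UFunMap) (u : UVal) :
    ULocalStep φ (loopCase.subst (.tm 0) (.con .ret [u])) (.val (.unit u)) :=
  .case (xs := [.tm 4]) (m := .val (.unit (.var (.tm 4)))) rfl rfl

/-- The pattern variables are replaced one after the other, so the second must not occur in `v`. -/
theorem ULocalStep.loopCase_apply (φ : UFunMap) (hv : v.subst (.tm 2) w = v) :
    ULocalStep φ (loopCase.subst (.tm 0) (.con .apply [v, w]))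
      (.val (.bind (.tm 3) (.app v w)
        (.val (sendThen (.con .ret [.var (.tm 3)]) (.val .loop))))) := by
  have hstep : ULocalStep φ (loopCase.subst (.tm 0) (.con .apply [v, w]))
      (.val (.bind (.tm 3) (.app (v.subst (.tm 2) w) w)
        (.val (sendThen (.con .ret [.var (.tm 3)]) (.val .loop))))) :=
    .case (xs := [.tm 1, .tm 2])
      (m := .val (.bind (.tm 3) (.app (.var (.tm 1)) (.var (.tm 2)))
        (.val (sendThen (.con .ret [.var (.tm 3)]) (.val .loop))))) rfl rfl
  rwa [hv] at hstep

theorem Reduces.serve (hv : v.subst (.tm 2) w = v)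
    (h : ∀ k, Reduces p a (bindCtx k) e₂ (.app v w) (.val (.unit u))) :
    Reduces p a (bindCtx k) e₂ (loopCase.subst (.tm 0) (.con .apply [v, w]))
      (.val (sendThen (.con .ret [u]) (.val .loop))) :=
  .trans (Reduces.of_local (.loopCase_apply _ hv)) (Reduces.bind h)

theorem Reduces.remoteCall (hv : v.subst (.tm 2) w = v)
    (h : ∀ k, Reduces p a.other (bindCtx k) e (.app v w) (.val (.unit u))) :
    Reduces p a e (bindCtx k₂) (.val (remoteCall v w)) (.val (.unit u)) := by
  have hserve := Reduces.serve (k := k₂) hv h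
  have hsend := UStep.comm_at p a.other (.con .ret [u]) (bindCtx k₂) e
  rw [Reduces, UConf.mkAt_other, UConf.mkAt_other] at hserve
  rw [UConf.mkAt_other, UConf.mkAt_other] at hsend
  exact .head (UStep.comm_at p a (.con .apply [v, w]) e (bindCtx k₂))
    (.trans (hserve.tail hsend) (Reduces.of_local (.loopCase_ret _ u)))

end Reduces

section Simulation

variable {P : Program} {D : Decomp} {a b : Side} {k k₂ : List (UVar × UTm)} {M : Tm}
  {V W V' U : Val} {A B : Ty}

theorem Ev.simulate (hP : P.WF D) (he : Ev (P.at a) M V) (h : Typing D 0 0 [] (.const a) M A)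
    (e e₂ : UECtx) : Reduces P.comp a e e₂ (M.comp a) (.val (V.comp a)) := by
  induction he generalizing A e with
  | val => exact .refl
  | letin heM _ ih₁ ih₂ =>
    cases h with
    | letin hM hN =>
      have hbody := ih₂ (hN.subst_head hP.decomp_ok trivial (heM.typing hP hM)) e
      rw [Tm.comp_subst] at hbody
      exact .trans (Reduces.letin (ih₁ hM)) hbody
  | step hM hs _ ih =>
    have hrest := ih (hs.typing hP h) e
    obtain heq | hstep := hs.comp hP hM h
    · rwa [heq]
    · exact .trans (Reduces.of_local hstep) hrest

theorem Typing.comp_subst_eq_self {L : Loc} (h : Typing D 0 0 [] L (.val V) A) (x : Name) :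
    (V.comp a).subst (.tm x) (W.comp a) = V.comp a := by
  rw [← Val.comp_subst, Tm.val.inj (h.subst_eq_self (x := x) rfl W)]

theorem Ev.simulate_remote (hP : P.WF D) (he : Ev (P.at a.other) (.app V W) V')
    (hr : RunVal P a.other V' U)
    (hV : Typing D 0 0 [] (.const a) (.val V) (.clo (.fn A (.const a.other) (.T B))))
    (hW : Typing D 0 0 [] (.const a) (.val W) A) (hA : A.Reloc)
    (ih : ∀ k k₂, Reduces P.comp a.other (bindCtx k) (bindCtx k₂) (.val (V'.comp a.other))
      (.val (.unit (U.comp a.other)))) :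
    Reduces P.comp a (bindCtx k) (bindCtx k₂) (.val (remoteCall (V.comp a) (W.comp a)))
      (.val (.unit (U.comp a))) := by
  have happ := hV.app_of_remote hW hA
  obtain ⟨hU, hB⟩ := hr.typing hP (he.typing hP happ)
  rw [(hV.movable trivial).comp_eq a a.other, (hW.movable hA).comp_eq a a.other,
    (hU.movable hB).comp_eq a a.other]
  exact .remoteCall (hV.comp_subst_eq_self 2) fun k' =>
    .trans (he.simulate hP happ (bindCtx k') (bindCtx k)) (ih k' k)

theorem RunVal.simulate (hP : P.WF D) (hr : RunVal P a V U)
    (h : Typing D 0 0 [] (.const a) (.val V) (.T A)) (k k₂ : List (UVar × UTm)) :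
    Reduces P.comp a (bindCtx k) (bindCtx k₂) (.val (V.comp a)) (.val (.unit (U.comp a))) := by
  induction hr generalizing A k k₂ with
  | unit => exact .refl
  | bind heM hrM heN _ ih₁ ih₂ =>
    cases h with
    | bind hM hN =>
      have hV := heM.typing hP hM
      have hN := hN.subst_head hP.decomp_ok trivial (hrM.typing hP hV).1
      have hbody := heN.simulate hP hN (bindCtx k) (bindCtx k₂)
      rw [Tm.comp_subst] at hbody
      exact .trans (Reduces.bind fun k' => .trans (heM.simulate hP hM _ _) (ih₁ hV k' k₂))
        (.trans hbody (ih₂ (heN.typing hP hN) k k₂))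
  | req he hr ih =>
    cases h with
    | req hV hW hA =>
      exact he.simulate_remote (a := .c) hP hr hV hW hA
        (ih (he.typing hP (hV.app_of_remote hW hA)))
  | call he hr ih =>
    cases h with
    | call hV hW hA =>
      exact he.simulate_remote (a := .s) hP hr hV hW hA
        (ih (he.typing hP (hV.app_of_remote hW hA)))
  | gen he _ ih =>
    cases h with
    | gen hV hW hA =>
      have happ := Typing.app hV hW
      exact .genCall_self fun k' => .trans (he.simulate hP happ (bindCtx k') (bindCtx k₂))
        (ih (he.typing hP happ) k' k₂)
  | genReq _ ih =>
    cases h with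
    | gen hV hW hA =>
      exact .bindUnit_of_local (.ifClient_server _ _ _) fun k' => ih (.req hV hW hA) k' k₂
  | genCall _ ih =>
    cases h with
    | gen hV hW hA =>
      exact .bindUnit_of_local (.ifClient_client _ _ _) fun k' => ih (.call hV hW hA) k' k₂

end Simulation

end LamCS

theorem mainTheorem4 (P : LamCS.Program) (D : LamCS.Decomp) (hP : P.WF D)
    (M : LamCS.Tm) (A : LamCS.Ty) (hM : LamCS.Typing D 0 0 [] (.const .c) M (.T A))
    (V : LamCS.Val)
    (hred : Relation.ReflTransGen (LamCS.Step P)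
      (.client M [] []) (.client (.val (.unit V)) [] [])) :
    Relation.ReflTransGen (LamCS.UStep P.comp)
      ⟨M.comp .c, .val .loop⟩ ⟨(LamCS.Tm.val (.unit V)).comp .c, .val .loop⟩ := by
  obtain ⟨V', hev, hrun⟩ := LamCS.run_of_steps hP hM hred
  exact .trans (hev.simulate hP hM (.ofLet .hole) (.ofLet .hole))
    (hrun.simulate hP (hev.typing hP hM) [] [])
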